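/- **Theorem.** Let $\Omega\subset\mathbb R^n$ be a bounded domain (open and connected) with Lipschitz boundary $\Gamma=\partial\Omega$, where $\Gamma=\Gamma_1\cup\Gamma_2$ with $\Gamma_1,\Gamma_2$ disjoint, measurable and of positive $(n-1)$-dimensional surface measure $d\gamma$. Put $H=L^2(\Omega)$, $Q=L^2(\Gamma_2)$, $V=H^1(\Omega)$, $V_0=\{v\in V: v|_{\Gamma_1}=0\}$ and $a(u,v)=\int_\Omega\nabla u\cdot\nabla v\,dx$. Let $g,z_d\in H$, let $b\in H^{1/2}(\Gamma_1)$ (that is, $b$ is the restriction to $\Gamma_1$ of the trace of a function of $V$), let $M>0$ and let $q_0^*\in Q$ with $q_0^*\neq0$. *Problem $P$.* For all data $b\in H^{1/2}(\Gamma_1)$, $q\in Q$, $g\in H$ there is exactly one $u=u_{bqg}\in V$ with $u|_{\Gamma_1}=b$ and $$a(u,v)=\int_\Omega g v\,dx-\int_{\Gamma_2}q v\,d\gamma\qquad\text{for all } v\in V_0 .$$ For the given $b$, $g$ and $z_d$, let $J^*(q)=\tfrac12\|u_{bqg}-z_d\|_H^2+\tfrac M2\|q\|_Q^2$ for $q\in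 Q$. Then the problem of minimizing $J^*(\lambda q_0^*)$ over $\lambda\in\mathbb R$ has exactly one solution $\bar\lambda_\infty$. Let $u_b$, $u_{q_0^*}$ and $u_g$ be the solutions of $P$ for the data $(b,0,0)$, $(0,q_0^*,0)$ and $(0,0,g)$ (in the order boundary temperature, flux, source). Then $$\bar\lambda_\infty=-\frac{B}{2A},\qquad A=\frac M2\int_{\Gamma_2}(q_0^*)^2\,d\gamma+\frac12\int_\Omega u_{q_0^*}^2\,dx>0,\qquad B=\int_\Omega u_{q_0^*}\,(u_b+u_g-z_d)\,dx .$$ *Problem $P_\alpha$.* For each $\alpha>0$ and all data $b\in H^{1/2}(\Gamma_1)$, $q\in Q$, $g\in H$ there is exactly one $u=u_{\alpha bqg}\in V$ with $$a(u,v)+\alpha\int_{\Gamma_1}u v\,d\gamma=\int_\Omega g v\,dx-\int_{\Gamma_2}q v\,d\gamma+\alpha\int_{\Gamma_1}b v\,d\gamma\qquad\text{for all } v\in V .$$ For the given $b$, $g$ and $z_d$, let $J^*_\alpha(q)=\tfrac12\|u_{\alpha bqg}-z_d\|_H^2+\tfrac M2\|q\|_Q^2$ for $q\in Q$. Then the problem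 of minimizing $J^*_\alpha(\lambda q_0^*)$ over $\lambda\in\mathbb R$ has exactly one solution $\bar\lambda_\alpha$, and $\bar\lambda_\alpha=-\dfrac{B_\alpha}{2A_\alpha}$, where $A_\alpha>0$ and $B_\alpha$ are given by the formulas for $A$ and $B$ with $u_b,u_{q_0^*},u_g$ replaced by the solutions of $P_\alpha$ for the data $(b,0,0)$, $(0,q_0^*,0)$ and $(0,0,g)$. -/

import Mathlib

open MeasureTheory Filter Topology
open scoped ContDiff NNReal ENNReal

noncomputable section

/-- `ℝⁿ` with its Euclidean norm. -/
abbrev RSpace (n : ℕ) := EuclideanSpace ℝ (Fin n)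

/-- The surface measure `dγ`: the `(n-1)`-dimensional Hausdorff measure on `ℝⁿ`, normalised so that
it agrees with Lebesgue measure on `(n-1)`-dimensional affine subspaces. -/
def surfaceMeasure (n : ℕ) : Measure (RSpace n) := μHE[n - 1]

/-- The space `H = L²(Ω)`. -/
abbrev L2Dom {n : ℕ} (Ω : Set (RSpace n)) := Lp ℝ 2 (volume.restrict Ω)

/-- The space `L²(Ω; ℝⁿ)` of square integrable vector fields. -/
abbrev L2Field {n : ℕ} (Ω : Set (RSpace n)) := Lp (RSpace n) 2 (volume.restrict Ω)

/-- The space `L²(Γ)` of a portion `Γ` of the boundary; `Q = L²(Γ₂)`. -/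
abbrev L2Bdry {n : ℕ} (Γ : Set (RSpace n)) := Lp ℝ 2 ((surfaceMeasure n).restrict Γ)

/-- `Ω` has a Lipschitz boundary: near each boundary point and in suitable orthonormal coordinates
with last axis `e`, the set `Ω` is the strict epigraph of a Lipschitz function `h` of the remaining
coordinates; the remaining coordinates of `x` are given by the projection `x - ⟨e, x⟩ e` of `x`
onto the hyperplane orthogonal to `e`. -/
def HasLipschitzBoundary {n : ℕ} (Ω : Set (RSpace n)) : Prop :=
  ∀ x₀ ∈ frontier Ω, ∃ (e : RSpace n) (r : ℝ) (K : ℝ≥0) (h : RSpace n → ℝ),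
    ‖e‖ = 1 ∧ 0 < r ∧ LipschitzWith K h ∧
      ∀ x ∈ Metric.ball x₀ r, x ∈ Ω ↔ h (x - inner ℝ e x • e) < inner ℝ e x

/-- `G` is the weak gradient of `u` on `Ω`: `∫_Ω u ∂φ/∂ξ dx = - ∫_Ω φ G·ξ dx` for all test functions
`φ ∈ C_c^∞(Ω)` and all directions `ξ`. -/
def IsWeakGradient {n : ℕ} (Ω : Set (RSpace n)) (u : L2Dom Ω) (G : L2Field Ω) : Prop :=
  ∀ φ : RSpace n → ℝ, ContDiff ℝ ∞ φ → HasCompactSupport φ → tsupport φ ⊆ Ω →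
    ∀ ξ : RSpace n,
      ∫ x in Ω, u x * fderiv ℝ φ x ξ = - ∫ x in Ω, φ x * inner ℝ (G x) ξ

/-- The Sobolev space `V = H¹(Ω)`. -/
@[ext]
structure SobolevH1 {n : ℕ} (Ω : Set (RSpace n)) where
  /-- the underlying square integrable function -/
  fn : L2Dom Ω
  /-- its weak gradient -/
  grad : L2Field Ω
  isWeakGradient : IsWeakGradient Ω fn grad

/-- `w ∈ L²(∂Ω)` is the trace of `v ∈ H¹(Ω)`: there are functions `φₖ ∈ C^∞(ℝⁿ)` with `φₖ → v` in
`H¹(Ω)` and `φₖ|_{∂Ω} → w` in `L²(∂Ω)`. On a bounded Lipschitz domain smooth functions are dense in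
`H¹(Ω)` and restriction to the boundary is continuous from `H¹(Ω)` to `L²(∂Ω)`, so that this
relation is the graph of the usual trace operator, defined on all of `H¹(Ω)`. -/
def HasTrace {n : ℕ} {Ω : Set (RSpace n)} (v : SobolevH1 Ω) (w : L2Bdry (frontier Ω)) : Prop :=
  ∃ φ : ℕ → RSpace n → ℝ, (∀ k, ContDiff ℝ ∞ (φ k)) ∧
    Tendsto (fun k => eLpNorm (fun x => φ k x - v.fn x) 2 (volume.restrict Ω)) atTop (𝓝 0) ∧
    Tendsto (fun k => eLpNorm (fun x => gradient (φ k) x - v.grad x) 2 (volume.restrict Ω))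
      atTop (𝓝 0) ∧
    Tendsto (fun k => eLpNorm (fun x => φ k x - w x) 2
      ((surfaceMeasure n).restrict (frontier Ω))) atTop (𝓝 0)

/-- `w = b` on the portion `Γ` of the boundary. -/
def AgreesOn {n : ℕ} {Ω : Set (RSpace n)} (Γ : Set (RSpace n)) (w : L2Bdry (frontier Ω))
    (b : L2Bdry Γ) : Prop :=
  (w : RSpace n → ℝ) =ᵐ[(surfaceMeasure n).restrict Γ] b

/-- `b ∈ H^{1/2}(Γ)`: `b` is the restriction to `Γ` of the trace of a function of `H¹(Ω)`. -/
def MemHHalf {n : ℕ} (Ω Γ : Set (RSpace n)) (b : L2Bdry Γ) : Prop :=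
  ∃ (v : SobolevH1 Ω) (w : L2Bdry (frontier Ω)), HasTrace v w ∧ AgreesOn Γ w b

/-- The bilinear form `a(u, v) = ∫_Ω ∇u·∇v dx`. -/
def formA {n : ℕ} {Ω : Set (RSpace n)} (u v : SobolevH1 Ω) : ℝ :=
  ∫ x in Ω, inner ℝ (u.grad x) (v.grad x)

/-- The linear form `L(v) = (g, v)_H - (q, v)_Q`, where `z` is the trace of `v`. -/
def formL {n : ℕ} {Ω Γ₂ : Set (RSpace n)} (g : L2Dom Ω) (q : L2Bdry Γ₂)
    (v : SobolevH1 Ω) (z : L2Bdry (frontier Ω)) : ℝ :=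
  (∫ x in Ω, g x * v.fn x) - ∫ x in Γ₂, q x * z x ∂(surfaceMeasure n)

/-- `u` solves the variational equality of the problem `P` for the data `b`, `q`, `g`:
`u ∈ H¹(Ω)`, `u = b` on `Γ₁`, and `a(u, v) = L(v)` for all `v ∈ V₀`, that is, for all `v ∈ H¹(Ω)`
with zero trace on `Γ₁`. -/
def IsSolutionP {n : ℕ} {Ω Γ₁ Γ₂ : Set (RSpace n)} (b : L2Bdry Γ₁) (q : L2Bdry Γ₂)
    (g : L2Dom Ω) (u : SobolevH1 Ω) : Prop :=
  (∃ w : L2Bdry (frontier Ω), HasTrace u w ∧ AgreesOn Γ₁ w b) ∧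
    ∀ (v : SobolevH1 Ω) (z : L2Bdry (frontier Ω)), HasTrace v z → AgreesOn Γ₁ z 0 →
      formA u v = formL g q v z

/-- `u` solves the variational equality of the problem `P_α` for the data `b`, `q`, `g`:
`u ∈ H¹(Ω)` and `a(u, v) + α ∫_{Γ₁} u v dγ = L(v) + α ∫_{Γ₁} b v dγ` for all `v ∈ H¹(Ω)`. -/
def IsSolutionPα {n : ℕ} {Ω Γ₁ Γ₂ : Set (RSpace n)} (α : ℝ) (b : L2Bdry Γ₁) (q : L2Bdry Γ₂)
    (g : L2Dom Ω) (u : SobolevH1 Ω) : Prop :=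
  ∃ w : L2Bdry (frontier Ω), HasTrace u w ∧
    ∀ (v : SobolevH1 Ω) (z : L2Bdry (frontier Ω)), HasTrace v z →
      formA u v + α * ∫ x in Γ₁, w x * z x ∂(surfaceMeasure n) =
        formL g q v z + α * ∫ x in Γ₁, b x * z x ∂(surfaceMeasure n)

open Classical in
/-- The solution of the problem `P`, as an element of `H` (and `0` if there is none). -/
def stateP {n : ℕ} {Ω Γ₁ Γ₂ : Set (RSpace n)} (b : L2Bdry Γ₁) (q : L2Bdry Γ₂)
    (g : L2Dom Ω) : L2Dom Ω :=
  if h : ∃ u : SobolevH1 Ω, IsSolutionP b q g u then h.choose.fn else 0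

open Classical in
/-- The solution of the problem `P_α`, as an element of `H` (and `0` if there is none). -/
def statePα {n : ℕ} {Ω Γ₁ Γ₂ : Set (RSpace n)} (α : ℝ) (b : L2Bdry Γ₁) (q : L2Bdry Γ₂)
    (g : L2Dom Ω) : L2Dom Ω :=
  if h : ∃ u : SobolevH1 Ω, IsSolutionPα α b q g u then h.choose.fn else 0

/-- The cost functional `J*(q) = ½ ‖u_q - z_d‖_H² + (M/2) ‖q‖_Q²`. -/
def costP {n : ℕ} {Ω Γ₁ Γ₂ : Set (RSpace n)} (M : ℝ) (b : L2Bdry Γ₁) (g zd : L2Dom Ω)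
    (q : L2Bdry Γ₂) : ℝ :=
  1 / 2 * ‖stateP b q g - zd‖ ^ 2 + M / 2 * ‖q‖ ^ 2

/-- The cost functional `J*_α(q) = ½ ‖u_{αq} - z_d‖_H² + (M/2) ‖q‖_Q²`. -/
def costPα {n : ℕ} {Ω Γ₁ Γ₂ : Set (RSpace n)} (M α : ℝ) (b : L2Bdry Γ₁) (g zd : L2Dom Ω)
    (q : L2Bdry Γ₂) : ℝ :=
  1 / 2 * ‖statePα α b q g - zd‖ ^ 2 + M / 2 * ‖q‖ ^ 2

/-- `A = (M/2) ∫_{Γ₂} q₀² dγ + ½ ∫_Ω u_{q₀}² dx`. -/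
def coeffA {n : ℕ} {Ω Γ₂ : Set (RSpace n)} (M : ℝ) (q₀ : L2Bdry Γ₂) (uq : L2Dom Ω) : ℝ :=
  M / 2 * (∫ x in Γ₂, q₀ x ^ 2 ∂(surfaceMeasure n)) + 1 / 2 * ∫ x in Ω, uq x ^ 2

/-- `B = ∫_Ω u_{q₀} (u_b + u_g - z_d) dx`. -/
def coeffB {n : ℕ} {Ω : Set (RSpace n)} (uq ub ug zd : L2Dom Ω) : ℝ :=
  ∫ x in Ω, uq x * (ub x + ug x - zd x)

/-- `l` is a minimizer of `F` over `ℝ`. -/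
def IsRealMinimizer (F : ℝ → ℝ) (l : ℝ) : Prop := ∀ m : ℝ, F l ≤ F m

end

/-!
The state `u` is sought in the Hilbert space of triples `(u, ∇u, u|_∂Ω)`, a closed subspace of
`L²(Ω) × L²(Ω; ℝⁿ) × L²(∂Ω)`. A trace is by definition a limit of restrictions of smooth functions,
so this space consists of weak gradients that are limits of triples of smooth functions, and every
estimate needed on it may be proved for smooth functions and then passed to the limit; neither the
density of smooth functions in `H¹(Ω)` nor a compactness theorem is required. Both problems are
variational equalities for forms that are coercive as soon as
`‖u‖² + ‖∇u‖² + ‖u|_∂Ω‖² ≤ K (‖∇u‖² + ‖u|_Γ₁‖²)` (`TraceSpace.exists_norm_sq_le`), so the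
Lax–Milgram theorem (`existsUnique_of_coerciveOn`) gives existence and uniqueness.

The estimate contains a trace inequality and a Poincaré inequality. Both are instances of a single
notion, `PoincarePair Ω μ ν`: the double integral of `|φ(x) - φ(y)|²` against `μ` and `ν` is at most
a multiple of `∫_Ω |∇φ|²`. This relation between finite measures is symmetric, additive in each
argument and transitive through nonzero measures (`PoincarePair.trans`), so it only has to be
established locally.
* A ball is linked to itself by integrating `∇φ` along segments (`Convex.poincarePair`), and
  connectedness of `Ω` links any two balls in `Ω` (`IsPreconnected.poincarePair_ball`).
* Near a boundary point the vertical direction of a local graph carries both `Ω` and `∂Ω` into a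
  ball inside `Ω`, without leaving `Ω` (`exists_nhds_poincarePair_ball`). This links them to the
  ball (`PoincarePair.of_flow`), provided the flow does not concentrate: for Lebesgue measure this is
  translation invariance, for the surface measure it is the fact that a Lipschitz graph has surface
  measure at most a multiple of the Lebesgue measure of its projection
  (`lintegral_graph_lintegral_le`).
Compactness of the closure of `Ω` then links `∂Ω` and `Ω` to `Ω`
(`poincarePair_of_hasLipschitzBoundary`).

Finally, by linearity and uniqueness the state for the flux `λ q₀` is `u_b + u_g + λ u_{q₀}`, so the
cost along the line is the quadratic polynomial `A λ² + B λ + const` with `A > 0`, whose only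
minimizer is `-B / (2 A)`.
-/

/-! ### Linking measures through a domain -/

section PoincarePairs

variable {E : Type*} [NormedAddCommGroup E] [InnerProductSpace ℝ E]

theorem sq_lintegral_le_measure_univ_mul_lintegral_sq {X : Type*} [MeasurableSpace X]
    (μ : Measure X) {f : X → ℝ≥0∞} (hf : AEMeasurable f μ) :
    (∫⁻ x, f x ∂μ) ^ 2 ≤ μ Set.univ * ∫⁻ x, f x ^ 2 ∂μ := by
  have h := ENNReal.lintegral_mul_le_Lp_mul_Lq μ Real.HolderConjugate.two_two
    (f := fun _ => 1) (g := f) aemeasurable_const hf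
  have h2 := pow_le_pow_left' h 2
  simp only [Pi.mul_apply, one_mul, lintegral_const, mul_pow, ENNReal.rpow_ofNat, one_pow] at h2
  simpa only [← ENNReal.rpow_natCast, ← ENNReal.rpow_mul, Nat.cast_ofNat, one_div,
    inv_mul_cancel₀ (two_ne_zero' ℝ), ENNReal.rpow_one] using h2

theorem ENNReal.add_sq_le_two_mul (a b : ℝ≥0∞) : (a + b) ^ 2 ≤ 2 * a ^ 2 + 2 * b ^ 2 := by
  have h := ENNReal.rpow_add_le_mul_rpow_add_rpow a b (p := 2) (by norm_num)
  have e : (2 : ℝ) - 1 = 1 := by norm_num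
  rw [e, ENNReal.rpow_one, mul_add] at h
  simpa [ENNReal.rpow_ofNat] using h

theorem enorm_sub_sq_le_two_mul (a b c : ℝ) :
    ‖a - b‖ₑ ^ 2 ≤ 2 * ‖a - c‖ₑ ^ 2 + 2 * ‖c - b‖ₑ ^ 2 := by
  refine le_trans (pow_le_pow_left' ?_ 2) (ENNReal.add_sq_le_two_mul _ _)
  simpa using enorm_add_le (a - c) (c - b)

/-- The fundamental theorem of calculus along a segment, combined with the Cauchy–Schwarz
inequality. -/
theorem enorm_sub_sq_le_lintegral_fderiv {φ : E → ℝ} (hφ : ContDiff ℝ 1 φ) (x v : E) {s : ℝ}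
    (hs : 0 ≤ s) :
    ‖φ x - φ (x + s • v)‖ₑ ^ 2 ≤ ENNReal.ofReal s * (‖v‖ₑ ^ 2 *
      ∫⁻ t in Set.Ioc 0 s, ‖fderiv ℝ φ (x + t • v)‖ₑ ^ 2) := by
  have hc : Continuous fun t : ℝ => fderiv ℝ φ (x + t • v) :=
    (hφ.continuous_fderiv one_ne_zero).comp (by fun_prop)
  have hd : ∀ t : ℝ, HasDerivAt (fun t : ℝ => φ (x + t • v)) (fderiv ℝ φ (x + t • v) v) t := by
    intro t
    have h1 : HasDerivAt (fun t : ℝ => x + t • v) v t := by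
      simpa using ((hasDerivAt_id t).smul_const v).const_add x
    exact ((hφ.differentiable one_ne_zero) (x + t • v)).hasFDerivAt.comp_hasDerivAt t h1
  have hftc := intervalIntegral.integral_eq_sub_of_hasDerivAt (a := 0) (b := s)
    (fun t _ => hd t) ((hc.clm_apply continuous_const).intervalIntegrable _ _)
  rw [zero_smul, add_zero, intervalIntegral.integral_of_le hs] at hftc
  have h1 : ‖φ x - φ (x + s • v)‖ₑ ≤
      ∫⁻ t in Set.Ioc 0 s, ‖v‖ₑ * ‖fderiv ℝ φ (x + t • v)‖ₑ := by
    rw [← enorm_neg, neg_sub, ← hftc]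
    refine (enorm_integral_le_lintegral_enorm _).trans (lintegral_mono fun t => ?_)
    rw [mul_comm]
    exact ContinuousLinearMap.le_opENorm _ _
  have hm : Measurable fun t : ℝ => ‖v‖ₑ * ‖fderiv ℝ φ (x + t • v)‖ₑ :=
    hc.enorm.measurable.const_mul _
  refine (pow_le_pow_left' h1 2).trans
    ((sq_lintegral_le_measure_univ_mul_lintegral_sq _ hm.aemeasurable).trans (le_of_eq ?_))
  simp only [mul_pow]
  rw [lintegral_const_mul _ (hc.enorm.measurable.pow_const 2)]
  simp

variable [FiniteDimensional ℝ E] [MeasurableSpace E] [BorelSpace E]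

/-- The measures `μ` and `ν` are linked through `Ω` if the mean square oscillation of a function
between `μ` and `ν` is controlled by its Dirichlet energy on `Ω`. Working with `ℝ≥0∞`-valued
integrals makes the inequality meaningful without integrability assumptions. -/
def PoincarePair (Ω : Set E) (μ ν : Measure E) : Prop :=
  ∃ C : ℝ≥0, ∀ φ : E → ℝ, ContDiff ℝ 1 φ →
    ∫⁻ x, ∫⁻ y, ‖φ x - φ y‖ₑ ^ 2 ∂ν ∂μ ≤ C * ∫⁻ z in Ω, ‖fderiv ℝ φ z‖ₑ ^ 2

theorem measurable_enorm_sub_sq {φ : E → ℝ} (hφ : ContDiff ℝ 1 φ) :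
    Measurable fun p : E × E => ‖φ p.1 - φ p.2‖ₑ ^ 2 := by
  have := hφ.continuous
  exact (by fun_prop : Continuous fun p : E × E => ‖φ p.1 - φ p.2‖ₑ ^ 2).measurable

theorem PoincarePair.symm {Ω : Set E} {μ ν : Measure E} [SFinite μ] [SFinite ν]
    (h : PoincarePair Ω μ ν) : PoincarePair Ω ν μ := by
  obtain ⟨C, hC⟩ := h
  refine ⟨C, fun φ hφ => ?_⟩
  rw [lintegral_lintegral_swap (measurable_enorm_sub_sq hφ).aemeasurable]
  simpa only [enorm_sub_rev] using hC φ hφ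

theorem PoincarePair.mono {Ω Ω' : Set E} {μ μ' ν ν' : Measure E} (h : PoincarePair Ω μ ν)
    (hΩ : Ω ⊆ Ω') (hμ : μ' ≤ μ) (hν : ν' ≤ ν) : PoincarePair Ω' μ' ν' := by
  obtain ⟨C, hC⟩ := h
  refine ⟨C, fun φ hφ => ?_⟩
  refine (lintegral_mono' hμ fun x => lintegral_mono' hν le_rfl).trans ((hC φ hφ).trans ?_)
  gcongr

theorem PoincarePair.add_left {Ω : Set E} {μ μ' ν : Measure E} (h : PoincarePair Ω μ ν)
    (h' : PoincarePair Ω μ' ν) : PoincarePair Ω (μ + μ') ν := by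
  obtain ⟨C, hC⟩ := h
  obtain ⟨C', hC'⟩ := h'
  refine ⟨C + C', fun φ hφ => ?_⟩
  rw [lintegral_add_measure, ENNReal.coe_add, add_mul]
  exact add_le_add (hC φ hφ) (hC' φ hφ)

theorem PoincarePair.zero_left (Ω : Set E) (ν : Measure E) : PoincarePair Ω 0 ν :=
  ⟨0, fun φ _ => by simp⟩

/-- Compare `φ x` and `φ y` with `φ z`, and average over `z` with respect to `ν`. -/
theorem PoincarePair.trans {Ω : Set E} {μ ν ρ : Measure E} [IsFiniteMeasure μ]
    [IsFiniteMeasure ν] [IsFiniteMeasure ρ] [NeZero ν] (h : PoincarePair Ω μ ν)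
    (h' : PoincarePair Ω ν ρ) : PoincarePair Ω μ ρ := by
  obtain ⟨C, hC⟩ := h
  obtain ⟨C', hC'⟩ := h'
  have hν0 : ν Set.univ ≠ 0 := by simpa using NeZero.ne ν
  have hνt : ν Set.univ ≠ ⊤ := measure_ne_top _ _
  obtain ⟨K, hK⟩ : ∃ K : ℝ≥0∞,
      K = (ν Set.univ)⁻¹ * (2 * ρ Set.univ * C + 2 * μ Set.univ * C') := ⟨_, rfl⟩
  have hKt : K ≠ ⊤ := by
    have hμt : μ Set.univ ≠ ⊤ := measure_ne_top _ _
    have hρt : ρ Set.univ ≠ ⊤ := measure_ne_top _ _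
    rw [hK]
    finiteness
  refine ⟨K.toNNReal, fun φ hφ => ?_⟩
  rw [ENNReal.coe_toNNReal hKt, hK, mul_assoc, ← ENNReal.div_eq_inv_mul,
    ENNReal.le_div_iff_mul_le (Or.inl hν0) (Or.inl hνt)]
  have hm := measurable_enorm_sub_sq hφ
  have hc := hφ.continuous
  have hml : ∀ x, Measurable fun y => ‖φ x - φ y‖ₑ ^ 2 := fun x =>
    (by fun_prop : Continuous fun y => ‖φ x - φ y‖ₑ ^ 2).measurable
  have hmr : ∀ y, Measurable fun x => ‖φ x - φ y‖ₑ ^ 2 := fun y =>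
    (by fun_prop : Continuous fun x => ‖φ x - φ y‖ₑ ^ 2).measurable
  have hpt : ∀ x y, ‖φ x - φ y‖ₑ ^ 2 * ν Set.univ ≤
      2 * (∫⁻ z, ‖φ x - φ z‖ₑ ^ 2 ∂ν) + 2 * ∫⁻ z, ‖φ z - φ y‖ₑ ^ 2 ∂ν := by
    intro x y
    rw [← lintegral_const, ← lintegral_const_mul _ (hml x), ← lintegral_const_mul _ (hmr y),
      ← lintegral_add_left ((hml x).const_mul 2)]
    exact lintegral_mono fun z => enorm_sub_sq_le_two_mul _ _ _
  have hi1 : Measurable fun x => ∫⁻ z, ‖φ x - φ z‖ₑ ^ 2 ∂ν := hm.lintegral_prod_right'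
  have hi2 : Measurable fun y => ∫⁻ z, ‖φ z - φ y‖ₑ ^ 2 ∂ν := hm.lintegral_prod_left'
  calc (∫⁻ x, ∫⁻ y, ‖φ x - φ y‖ₑ ^ 2 ∂ρ ∂μ) * ν Set.univ
      = ∫⁻ x, ∫⁻ y, ‖φ x - φ y‖ₑ ^ 2 * ν Set.univ ∂ρ ∂μ := by
        rw [← lintegral_mul_const _ hm.lintegral_prod_right']
        exact lintegral_congr fun x => (lintegral_mul_const _ (hml x)).symm
    _ ≤ ∫⁻ x, ∫⁻ y, (2 * (∫⁻ z, ‖φ x - φ z‖ₑ ^ 2 ∂ν) +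
          2 * ∫⁻ z, ‖φ z - φ y‖ₑ ^ 2 ∂ν) ∂ρ ∂μ :=
        lintegral_mono fun x => lintegral_mono fun y => hpt x y
    _ = 2 * ρ Set.univ * (∫⁻ x, ∫⁻ z, ‖φ x - φ z‖ₑ ^ 2 ∂ν ∂μ) +
          2 * μ Set.univ * ∫⁻ z, ∫⁻ y, ‖φ z - φ y‖ₑ ^ 2 ∂ρ ∂ν := by
        simp_rw [lintegral_add_left measurable_const, lintegral_const]
        rw [lintegral_add_right _ measurable_const, lintegral_const,
          lintegral_mul_const _ (hi1.const_mul 2), lintegral_const_mul _ hi1,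
          lintegral_const_mul _ hi2,
          lintegral_lintegral_swap (f := fun y z => ‖φ z - φ y‖ₑ ^ 2)
            (by fun_prop : Continuous fun p : E × E => ‖φ p.2 - φ p.1‖ₑ ^ 2).aemeasurable]
        ring
    _ ≤ 2 * ρ Set.univ * (C * ∫⁻ z in Ω, ‖fderiv ℝ φ z‖ₑ ^ 2) +
          2 * μ Set.univ * (C' * ∫⁻ z in Ω, ‖fderiv ℝ φ z‖ₑ ^ 2) :=
        add_le_add (mul_le_mul_right (hC φ hφ) _) (mul_le_mul_right (hC' φ hφ) _)
    _ = _ := by ring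

end PoincarePairs

/-! ### Convex sets -/

section ConvexSets

variable {E : Type*} [NormedAddCommGroup E] [InnerProductSpace ℝ E] [FiniteDimensional ℝ E]
  [MeasurableSpace E] [BorelSpace E]

theorem lintegral_comp_smul_add_le {f : E → ℝ≥0∞} (hf : Measurable f) (a : E) {c : ℝ}
    (hc : 1 / 2 ≤ c) :
    ∫⁻ x, f (c • x + a) ≤ 2 ^ Module.finrank ℝ E * ∫⁻ x, f x := by
  have hc0 : 0 < c := by linarith
  have h1 : ∫⁻ x, f (c • x + a) = ENNReal.ofReal |(c ^ Module.finrank ℝ E)⁻¹| * ∫⁻ x, f x := by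
    rw [← lintegral_add_right_eq_self f a,
      ← smul_eq_mul, ← lintegral_smul_measure, ← Measure.map_addHaar_smul volume hc0.ne',
      lintegral_map (by fun_prop) (measurable_const_smul c)]
  rw [h1]
  gcongr
  rw [abs_of_nonneg (by positivity)]
  refine ENNReal.ofReal_le_of_le_toReal ?_
  rw [ENNReal.toReal_pow, ENNReal.toReal_ofNat, ← inv_pow]
  gcongr
  exact inv_le_of_inv_le₀ (by norm_num) (by linarith)

/-- The Poincaré inequality on a bounded convex set. -/
theorem Convex.poincarePair {B : Set E} (hB : Convex ℝ B) (hBm : MeasurableSet B)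
    (hBb : Bornology.IsBounded B) :
    PoincarePair B (volume.restrict B) (volume.restrict B) := by
  have hBt : volume B ≠ ⊤ := hBb.measure_lt_top.ne
  have hDt : Metric.ediam B ≠ ⊤ := hBb.ediam_ne_top
  obtain ⟨K, hK⟩ : ∃ K : ℝ≥0∞, K = Metric.ediam B ^ 2 *
    (2 ^ Module.finrank ℝ E * volume B) := ⟨_, rfl⟩
  have hKt : K ≠ ⊤ := by rw [hK]; finiteness
  refine ⟨K.toNNReal, fun φ hφ => ?_⟩
  rw [ENNReal.coe_toNNReal hKt, hK]
  have hcont : Continuous fun z => ‖fderiv ℝ φ z‖ₑ ^ 2 :=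
    (ENNReal.continuous_pow 2).comp (hφ.continuous_fderiv one_ne_zero).enorm
  obtain ⟨f, hf⟩ : ∃ f : E → ℝ≥0∞, f = B.indicator fun z => ‖fderiv ℝ φ z‖ₑ ^ 2 := ⟨_, rfl⟩
  have hfm : Measurable f := hf ▸ hcont.measurable.indicator hBm
  have hfi : ∫⁻ z in B, ‖fderiv ℝ φ z‖ₑ ^ 2 = ∫⁻ z, f z := by
    rw [hf, lintegral_indicator hBm]
  rw [hfi]
  have hpt : ∀ x ∈ B, ∀ y ∈ B, ‖φ x - φ y‖ₑ ^ 2 ≤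
      Metric.ediam B ^ 2 * ∫⁻ t in Set.Ioc (0 : ℝ) 1, f (x + t • (y - x)) := by
    intro x hx y hy
    have h := enorm_sub_sq_le_lintegral_fderiv hφ x (y - x) zero_le_one
    rw [one_smul, add_sub_cancel, ENNReal.ofReal_one, one_mul] at h
    refine h.trans ?_
    refine mul_le_mul' (pow_le_pow_left' ?_ 2) ?_
    · rw [← edist_eq_enorm_sub]
      exact Metric.edist_le_ediam_of_mem hy hx
    · refine le_of_eq (setLIntegral_congr_fun measurableSet_Ioc fun t ht => ?_)
      have hmem := hB.add_smul_sub_mem hx hy ⟨ht.1.le, ht.2⟩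
      simp only [hf, Set.indicator_of_mem hmem]
  have hm3 : Measurable fun p : (E × E) × ℝ => f (p.1.1 + p.2 • (p.1.2 - p.1.1)) := by
    fun_prop
  -- For `t ≤ 1/2` the variable `x`, and otherwise the variable `y`, enters with a factor
  -- bounded below, so that a change of variables controls the corresponding integral.
  have hslice : ∀ t ∈ Set.Ioc (0 : ℝ) 1,
      ∫⁻ x in B, ∫⁻ y in B, f (x + t • (y - x)) ≤
        2 ^ Module.finrank ℝ E * volume B * ∫⁻ z, f z := by
    intro t ht
    have hb : ∀ g : E → E → ℝ≥0∞,
        (∀ x, ∫⁻ y, g x y ≤ 2 ^ Module.finrank ℝ E * ∫⁻ z, f z) →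
        ∫⁻ x in B, ∫⁻ y in B, g x y ≤ 2 ^ Module.finrank ℝ E * volume B * ∫⁻ z, f z := by
      intro g hg
      calc ∫⁻ x in B, ∫⁻ y in B, g x y
          ≤ ∫⁻ _ in B, 2 ^ Module.finrank ℝ E * ∫⁻ z, f z :=
            lintegral_mono fun x => (setLIntegral_le_lintegral _ _).trans (hg x)
        _ = _ := by rw [setLIntegral_const]; ring
    rcases le_total t (1 / 2) with h | h
    · rw [lintegral_lintegral_swap
        (by fun_prop : Measurable fun p : E × E => f (p.1 + t • (p.2 - p.1))).aemeasurable]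
      refine hb (fun y x => f (x + t • (y - x))) fun y => ?_
      have := lintegral_comp_smul_add_le hfm (t • y) (c := 1 - t) (by linarith)
      refine le_trans (le_of_eq (lintegral_congr fun x => ?_)) this
      congr 1
      module
    · refine hb (fun x y => f (x + t • (y - x))) fun x => ?_
      have := lintegral_comp_smul_add_le hfm ((1 - t) • x) h
      refine le_trans (le_of_eq (lintegral_congr fun y => ?_)) this
      congr 1
      module
  calc ∫⁻ x in B, ∫⁻ y in B, ‖φ x - φ y‖ₑ ^ 2
      ≤ ∫⁻ x in B, ∫⁻ y in B, Metric.ediam B ^ 2 *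
          ∫⁻ t in Set.Ioc (0 : ℝ) 1, f (x + t • (y - x)) :=
        setLIntegral_mono' hBm fun x hx => setLIntegral_mono' hBm fun y hy => hpt x hx y hy
    _ = Metric.ediam B ^ 2 * ∫⁻ x in B, ∫⁻ y in B,
          ∫⁻ t in Set.Ioc (0 : ℝ) 1, f (x + t • (y - x)) := by
        have hm : Measurable fun p : E × E =>
          ∫⁻ t in Set.Ioc (0 : ℝ) 1, f (p.1 + t • (p.2 - p.1)) := hm3.lintegral_prod_right'
        rw [← lintegral_const_mul _ hm.lintegral_prod_right']
        exact lintegral_congr fun x => lintegral_const_mul _ (hm.comp measurable_prodMk_left)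
    _ = Metric.ediam B ^ 2 * ∫⁻ t in Set.Ioc (0 : ℝ) 1, ∫⁻ x in B, ∫⁻ y in B,
          f (x + t • (y - x)) := by
        congr 1
        have hm : Measurable fun p : (E × ℝ) × E => f (p.1.1 + p.1.2 • (p.2 - p.1.1)) := by
          fun_prop
        have hm' : Measurable fun p : E × ℝ => ∫⁻ y in B, f (p.1 + p.2 • (y - p.1)) :=
          hm.lintegral_prod_right'
        refine Eq.trans ?_ (lintegral_lintegral_swap hm'.aemeasurable)
        refine lintegral_congr fun x => lintegral_lintegral_swap ?_
        exact (by fun_prop : Measurable fun p : E × ℝ => f (x + p.2 • (p.1 - x))).aemeasurable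
    _ ≤ Metric.ediam B ^ 2 * ∫⁻ t in Set.Ioc (0 : ℝ) 1,
          2 ^ Module.finrank ℝ E * volume B * ∫⁻ z, f z := by
        exact mul_le_mul_right (setLIntegral_mono' measurableSet_Ioc hslice) _
    _ = _ := by
        rw [setLIntegral_const]
        simp [mul_assoc]

end ConvexSets

/-! ### Straight flows and chains of balls -/

section Linking

variable {E : Type*} [NormedAddCommGroup E] [InnerProductSpace ℝ E] [FiniteDimensional ℝ E]
  [MeasurableSpace E] [BorelSpace E]

/-- If the straight flow in the direction `e`, started from the measure `μ`, is spread out over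
`Ω` and ends up in a set `B` satisfying the Poincaré inequality, then `μ` and `B` are linked
through `Ω`. -/
theorem PoincarePair.of_flow {Ω S B : Set E} (hΩ : MeasurableSet Ω) (hB : MeasurableSet B)
    (hBt : volume B ≠ ⊤) {μ : Measure E} [IsFiniteMeasure μ] (hS : ∀ᵐ x ∂μ, x ∈ S) {e : E}
    {a L : ℝ} (ha : 0 ≤ a) (haL : a < L) {C : ℝ≥0}
    (hflow : ∀ f : E → ℝ≥0∞, Measurable f →
      ∫⁻ x, (∫⁻ t in Set.Ioc 0 L, f (x + t • e)) ∂μ ≤ C * ∫⁻ x, f x)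
    (hSΩ : ∀ x ∈ S, ∀ t ∈ Set.Ioc 0 L, x + t • e ∈ Ω)
    (hSB : ∀ x ∈ S, ∀ t ∈ Set.Ioc a L, x + t • e ∈ B)
    (h : PoincarePair Ω (volume.restrict B) (volume.restrict B)) :
    PoincarePair Ω μ (volume.restrict B) := by
  have : IsFiniteMeasure (volume.restrict B) := isFiniteMeasure_restrict.2 hBt
  obtain ⟨C', hC'⟩ := h
  refine PoincarePair.symm ?_
  have hLa0 : ENNReal.ofReal (L - a) ≠ 0 := by simpa using haL
  have hLat : ENNReal.ofReal (L - a) ≠ ⊤ := ENNReal.ofReal_ne_top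
  obtain ⟨D, hD⟩ : ∃ D : ℝ≥0∞,
    D = ENNReal.ofReal (L - a) * (2 * (ENNReal.ofReal L * ‖e‖ₑ ^ 2)) := ⟨_, rfl⟩
  have hDt : D ≠ ⊤ := by rw [hD]; finiteness
  obtain ⟨K, hK⟩ : ∃ K : ℝ≥0∞,
    K = (ENNReal.ofReal (L - a))⁻¹ * (D * C * volume B + 2 * C * C') := ⟨_, rfl⟩
  have hKt : K ≠ ⊤ := by rw [hK]; finiteness
  refine ⟨K.toNNReal, fun φ hφ => ?_⟩
  rw [ENNReal.coe_toNNReal hKt, hK, mul_assoc, ← ENNReal.div_eq_inv_mul,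
    ENNReal.le_div_iff_mul_le (Or.inl hLa0) (Or.inl hLat)]
  have hc := hφ.continuous
  have hcont : Continuous fun z => ‖fderiv ℝ φ z‖ₑ ^ 2 :=
    (ENNReal.continuous_pow 2).comp (hφ.continuous_fderiv one_ne_zero).enorm
  obtain ⟨g, hg⟩ : ∃ g : E → ℝ≥0∞, g = Ω.indicator fun z => ‖fderiv ℝ φ z‖ₑ ^ 2 := ⟨_, rfl⟩
  have hgm : Measurable g := hg ▸ hcont.measurable.indicator hΩ
  have hgi : ∫⁻ z in Ω, ‖fderiv ℝ φ z‖ₑ ^ 2 = ∫⁻ z, g z := by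
    rw [hg, lintegral_indicator hΩ]
  obtain ⟨k, hk⟩ : ∃ k : E → E → ℝ≥0∞, k = fun y => B.indicator fun z => ‖φ z - φ y‖ₑ ^ 2 :=
    ⟨_, rfl⟩
  have hkm : ∀ y, Measurable (k y) := fun y => by
    rw [hk]
    exact (by fun_prop : Continuous fun z => ‖φ z - φ y‖ₑ ^ 2).measurable.indicator hB
  have hki : ∀ y, ∫⁻ z, k y z = ∫⁻ z in B, ‖φ y - φ z‖ₑ ^ 2 := fun y => by
    rw [hk]
    simp only [enorm_sub_rev (φ y)]
    exact lintegral_indicator hB _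
  have hpt : ∀ y, ∀ x ∈ S, ‖φ y - φ x‖ₑ ^ 2 * ENNReal.ofReal (L - a) ≤
      D * (∫⁻ t in Set.Ioc 0 L, g (x + t • e)) +
        2 * ∫⁻ t in Set.Ioc 0 L, k y (x + t • e) := by
    intro y x hx
    have hsub : Set.Ioc a L ⊆ Set.Ioc 0 L := Set.Ioc_subset_Ioc_left ha
    have hkl : Measurable fun t : ℝ => k y (x + t • e) := (hkm y).comp (by fun_prop)
    have hstep : ∀ t ∈ Set.Ioc a L, ‖φ y - φ x‖ₑ ^ 2 ≤
        2 * (ENNReal.ofReal L * ‖e‖ₑ ^ 2) * (∫⁻ t in Set.Ioc 0 L, g (x + t • e)) +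
          2 * k y (x + t • e) := by
      intro t ht
      have h1 := enorm_sub_sq_le_lintegral_fderiv hφ x e (ha.trans ht.1.le)
      have h2 : ∫⁻ τ in Set.Ioc 0 t, ‖fderiv ℝ φ (x + τ • e)‖ₑ ^ 2 ≤
          ∫⁻ τ in Set.Ioc 0 L, g (x + τ • e) := by
        refine le_trans ?_ (lintegral_mono_set (Set.Ioc_subset_Ioc_right ht.2))
        refine setLIntegral_mono' measurableSet_Ioc fun τ hτ => ?_
        rw [hg, Set.indicator_of_mem (hSΩ x hx τ ⟨hτ.1, hτ.2.trans ht.2⟩)]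
      have h3 : k y (x + t • e) = ‖φ (x + t • e) - φ y‖ₑ ^ 2 := by
        rw [hk]
        exact Set.indicator_of_mem (hSB x hx t ht) _
      rw [enorm_sub_rev, h3, mul_assoc 2]
      refine (enorm_sub_sq_le_two_mul _ _ (φ (x + t • e))).trans (add_le_add_left ?_ _)
      refine mul_le_mul_right (h1.trans ?_) _
      rw [← mul_assoc]
      exact mul_le_mul' (mul_le_mul_left (ENNReal.ofReal_le_ofReal ht.2) _) h2
    calc ‖φ y - φ x‖ₑ ^ 2 * ENNReal.ofReal (L - a)
        = ∫⁻ _ in Set.Ioc a L, ‖φ y - φ x‖ₑ ^ 2 := by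
          rw [setLIntegral_const, Real.volume_Ioc]
      _ ≤ ∫⁻ t in Set.Ioc a L,
            (2 * (ENNReal.ofReal L * ‖e‖ₑ ^ 2) * (∫⁻ t in Set.Ioc 0 L, g (x + t • e)) +
              2 * k y (x + t • e)) := setLIntegral_mono' measurableSet_Ioc hstep
      _ = D * (∫⁻ t in Set.Ioc 0 L, g (x + t • e)) +
            2 * ∫⁻ t in Set.Ioc a L, k y (x + t • e) := by
          rw [lintegral_add_left measurable_const, setLIntegral_const, Real.volume_Ioc,
            lintegral_const_mul _ hkl, hD]
          ring
      _ ≤ _ := add_le_add_right (mul_le_mul_right (lintegral_mono_set hsub) _) _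
  have hgl : Measurable fun x => ∫⁻ t in Set.Ioc 0 L, g (x + t • e) := by
    have : Measurable fun p : E × ℝ => g (p.1 + p.2 • e) := by fun_prop
    exact this.lintegral_prod_right'
  have hkl : ∀ y, Measurable fun x => ∫⁻ t in Set.Ioc 0 L, k y (x + t • e) := by
    intro y
    have hy := hkm y
    have : Measurable fun p : E × ℝ => k y (p.1 + p.2 • e) := by fun_prop
    exact this.lintegral_prod_right'
  have hy : ∀ y, (∫⁻ x, ‖φ y - φ x‖ₑ ^ 2 ∂μ) * ENNReal.ofReal (L - a) ≤
      D * (C * ∫⁻ z, g z) + 2 * (C * ∫⁻ z in B, ‖φ y - φ z‖ₑ ^ 2) := by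
    intro y
    rw [← lintegral_mul_const _
      (by fun_prop : Continuous fun x => ‖φ y - φ x‖ₑ ^ 2).measurable]
    refine (lintegral_mono_ae (hS.mono fun x hx => hpt y x hx)).trans ?_
    rw [lintegral_add_left (hgl.const_mul _), lintegral_const_mul _ hgl,
      lintegral_const_mul _ (hkl y), ← hki]
    exact add_le_add (mul_le_mul_right (hflow g hgm) _)
      (mul_le_mul_right (hflow (k y) (hkm y)) _)
  have hmB : Measurable fun y => ∫⁻ z in B, ‖φ y - φ z‖ₑ ^ 2 :=
    (measurable_enorm_sub_sq hφ).lintegral_prod_right'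
  rw [← lintegral_mul_const _ (measurable_enorm_sub_sq hφ).lintegral_prod_right', hgi]
  refine (lintegral_mono hy).trans ?_
  rw [lintegral_add_left measurable_const, setLIntegral_const,
    lintegral_const_mul _ (hmB.const_mul _), lintegral_const_mul _ hmB]
  calc D * (C * ∫⁻ z, g z) * volume B +
        2 * (C * ∫⁻ y in B, ∫⁻ z in B, ‖φ y - φ z‖ₑ ^ 2)
      ≤ D * (C * ∫⁻ z, g z) * volume B + 2 * (C * (C' * ∫⁻ z, g z)) :=
        add_le_add_right (mul_le_mul_right (mul_le_mul_right (hgi ▸ hC' φ hφ) _) _) _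
    _ = _ := by ring

theorem PoincarePair.of_inter_nonempty {Ω U V : Set E} (hU : IsOpen U) (hV : IsOpen V)
    (hUc : Convex ℝ U) (hVc : Convex ℝ V) (hUb : Bornology.IsBounded U)
    (hVb : Bornology.IsBounded V) (hUΩ : U ⊆ Ω) (hVΩ : V ⊆ Ω) (hUV : (U ∩ V).Nonempty) :
    PoincarePair Ω (volume.restrict U) (volume.restrict V) := by
  have : IsFiniteMeasure (volume.restrict U) := isFiniteMeasure_restrict.2 hUb.measure_lt_top.ne
  have : IsFiniteMeasure (volume.restrict V) := isFiniteMeasure_restrict.2 hVb.measure_lt_top.ne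
  have : IsFiniteMeasure (volume.restrict (U ∩ V)) :=
    isFiniteMeasure_restrict.2 (hUb.subset Set.inter_subset_left).measure_lt_top.ne
  have : NeZero (volume.restrict (U ∩ V)) :=
    ⟨Measure.restrict_eq_zero.not.2 ((hU.inter hV).measure_pos volume hUV).ne'⟩
  exact PoincarePair.trans (ν := volume.restrict (U ∩ V))
    ((hUc.poincarePair hU.measurableSet hUb).mono hUΩ le_rfl
      (Measure.restrict_mono Set.inter_subset_left le_rfl))
    ((hVc.poincarePair hV.measurableSet hVb).mono hVΩ
      (Measure.restrict_mono Set.inter_subset_right le_rfl) le_rfl)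

/-- Any two balls contained in a connected open set are linked through it, by a chain of balls. -/
theorem IsPreconnected.poincarePair_ball {Ω : Set E} (hΩ : IsPreconnected Ω) (hΩo : IsOpen Ω)
    {x y : E} {r s : ℝ} (hr : 0 < r) (hs : 0 < s) (hx : Metric.ball x r ⊆ Ω)
    (hy : Metric.ball y s ⊆ Ω) :
    PoincarePair Ω (volume.restrict (Metric.ball x r)) (volume.restrict (Metric.ball y s)) := by
  have hpair : ∀ {x y : E} {r s : ℝ}, Metric.ball x r ⊆ Ω → Metric.ball y s ⊆ Ω →
      (Metric.ball x r ∩ Metric.ball y s).Nonempty →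
      PoincarePair Ω (volume.restrict (Metric.ball x r)) (volume.restrict (Metric.ball y s)) :=
    fun hx hy hxy => PoincarePair.of_inter_nonempty Metric.isOpen_ball Metric.isOpen_ball
      (convex_ball _ _) (convex_ball _ _) Metric.isBounded_ball Metric.isBounded_ball hx hy hxy
  have hfin : ∀ (x : E) (r : ℝ), IsFiniteMeasure (volume.restrict (Metric.ball x r)) := fun x r =>
    isFiniteMeasure_restrict.2 measure_ball_lt_top.ne
  have hne : ∀ (x : E) {r : ℝ}, 0 < r → NeZero (volume.restrict (Metric.ball x r)) := fun x r hr =>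
    ⟨Measure.restrict_eq_zero.not.2 (Metric.measure_ball_pos volume x hr).ne'⟩
  refine hΩ.induction₂ (fun x y => ∀ r s : ℝ, 0 < r → 0 < s → Metric.ball x r ⊆ Ω →
    Metric.ball y s ⊆ Ω → PoincarePair Ω (volume.restrict (Metric.ball x r))
      (volume.restrict (Metric.ball y s))) ?_ ?_ ?_ (hx (Metric.mem_ball_self hr))
      (hy (Metric.mem_ball_self hs)) r s hr hs hx hy
  · intro x hx
    obtain ⟨ρ, hρ, hρΩ⟩ := Metric.isOpen_iff.1 hΩo x hx
    filter_upwards [mem_nhdsWithin_of_mem_nhds (Metric.ball_mem_nhds x hρ)] with y hy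
    intro r s hr hs hxr hys
    have := hne x hρ
    exact (hpair hxr hρΩ ⟨x, Metric.mem_ball_self hr, Metric.mem_ball_self hρ⟩).trans
      (hpair hρΩ hys ⟨y, hy, Metric.mem_ball_self hs⟩)
  · intro x y z _ hy _ hxy hyz r s hr hs hxr hzs
    obtain ⟨ρ, hρ, hρΩ⟩ := Metric.isOpen_iff.1 hΩo y hy
    have := hne y hρ
    exact (hxy r ρ hr hρ hxr hρΩ).trans (hyz ρ s hρ hs hρΩ hzs)
  · intro x y _ _ hxy r s hr hs hyr hxs
    exact (hxy s r hs hr hxs hyr).symm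

end Linking

/-! ### Surface measure of Lipschitz graphs -/

section LipschitzGraphs

variable {E : Type*} [NormedAddCommGroup E] [InnerProductSpace ℝ E] [FiniteDimensional ℝ E]
  [MeasurableSpace E] [BorelSpace E]

theorem LipschitzWith.euclideanHausdorffMeasure_image_le {X Y : Type*} [EMetricSpace X]
    [EMetricSpace Y] [MeasurableSpace X] [BorelSpace X] [MeasurableSpace Y] [BorelSpace Y]
    {K : ℝ≥0} {f : X → Y} (hf : LipschitzWith K f) (d : ℕ) (s : Set X) :
    μHE[d] (f '' s) ≤ (K : ℝ≥0∞) ^ d * μHE[d] s := by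
  have h := hf.hausdorffMeasure_image_le (Nat.cast_nonneg d) s
  rw [ENNReal.rpow_natCast] at h
  simp only [Measure.euclideanHausdorffMeasure_def, Measure.smul_apply, ENNReal.smul_def,
    smul_eq_mul]
  rw [mul_left_comm]
  gcongr

/-- Fubini's theorem for the decomposition of space into lines parallel to a unit vector. -/
theorem lintegral_eq_lintegral_orthogonal_lintegral {e : E} (he : ‖e‖ = 1) {f : E → ℝ≥0∞}
    (hf : Measurable f) :
    ∫⁻ x, f x = ∫⁻ y : (ℝ ∙ e)ᗮ, ∫⁻ t : ℝ, f (y + t • e) := by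
  have h1 : ∫⁻ x, f x =
      ∫⁻ p : (ℝ ∙ e) × (ℝ ∙ e)ᗮ, f ((p.1 : E) + (p.2 : E)) := by
    have hf' : Measurable fun p => f ((ℝ ∙ e).orthogonalDecomposition.symm p) :=
      hf.comp (ℝ ∙ e).orthogonalDecomposition.symm.continuous.measurable
    rw [← (ℝ ∙ e).orthogonalDecomposition.symm.measurePreserving.lintegral_comp hf,
      ← (WithLp.volume_preserving_toLp (ℝ ∙ e) (ℝ ∙ e)ᗮ).lintegral_comp hf']
    rfl
  have hm : Measurable fun p : (ℝ ∙ e) × (ℝ ∙ e)ᗮ => f ((p.1 : E) + (p.2 : E)) :=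
    hf.comp (by fun_prop)
  rw [h1, Measure.volume_eq_prod, lintegral_prod_symm _ hm.aemeasurable]
  refine lintegral_congr fun y => ?_
  have hmy : Measurable fun k : (ℝ ∙ e) => f ((k : E) + (y : E)) := hf.comp (by fun_prop)
  rw [← (LinearIsometryEquiv.toSpanUnitSingleton (𝕜 := ℝ) e he).measurePreserving.lintegral_comp
    hmy]
  refine lintegral_congr fun t => ?_
  simp [add_comm]

variable {e : E} {K : ℝ≥0} {h : E → ℝ} {S : Set E}

/-- The projection of the surface measure of a Lipschitz graph along its vertical axis is bounded
by a multiple of the Lebesgue measure of the horizontal hyperplane. -/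
theorem map_surfaceMeasure_graph_le {d : ℕ} (hd : Module.finrank ℝ E = d + 1) (he : ‖e‖ = 1)
    (hh : LipschitzWith K h)
    (hSh : ∀ x ∈ S, h (x - inner ℝ e x • e) = inner ℝ e x) :
    ((μHE[d] : Measure E).restrict S).map (ℝ ∙ e)ᗮ.orthogonalProjectionOnto ≤
      ((1 + K : ℝ≥0) : ℝ≥0∞) ^ d • volume := by
  have he0 : e ≠ 0 := by rintro rfl; simp at he
  have : Fact (Module.finrank ℝ E = d + 1) := ⟨hd⟩
  have hvol : (volume : Measure (ℝ ∙ e)ᗮ) = μHE[d] := by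
    rw [← InnerProductSpace.euclideanHausdorffMeasure_eq_volume,
      Submodule.finrank_orthogonal_span_singleton (n := d) he0]
  have hlip : LipschitzWith (1 + K) fun y : (ℝ ∙ e)ᗮ => (y : E) + h y • e := by
    refine (LipschitzWith.subtype_val _).add ?_
    refine LipschitzWith.of_dist_le_mul fun y z => ?_
    rw [dist_eq_norm, ← sub_smul, norm_smul, he, mul_one, ← dist_eq_norm]
    exact hh.dist_le_mul _ _
  refine Measure.le_iff.2 fun A hA => ?_
  have hPm : Measurable (ℝ ∙ e)ᗮ.orthogonalProjectionOnto :=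
    (ℝ ∙ e)ᗮ.orthogonalProjectionOnto.continuous.measurable
  rw [Measure.map_apply hPm hA, Measure.restrict_apply (hPm hA), Measure.smul_apply, hvol,
    smul_eq_mul]
  refine le_trans (measure_mono ?_) (hlip.euclideanHausdorffMeasure_image_le d A)
  rintro x ⟨hxA, hxS⟩
  refine ⟨_, hxA, ?_⟩
  have hp : ((ℝ ∙ e)ᗮ.orthogonalProjectionOnto x : E) = x - inner ℝ e x • e := by
    rw [← Submodule.starProjection_apply, Submodule.starProjection_orthogonal_val,
      Submodule.starProjection_unit_singleton ℝ he]
  simp only [hp, hSh x hxS, sub_add_cancel]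

/-- Moving a Lipschitz graph along its vertical axis spreads its surface measure out over space,
with bounded density. -/
theorem lintegral_graph_lintegral_le {d : ℕ} (hd : Module.finrank ℝ E = d + 1) (he : ‖e‖ = 1)
    (hh : LipschitzWith K h)
    (hSh : ∀ x ∈ S, h (x - inner ℝ e x • e) = inner ℝ e x) {f : E → ℝ≥0∞} (hf : Measurable f) :
    ∫⁻ x in S, (∫⁻ t : ℝ, f (x + t • e)) ∂μHE[d] ≤
      ((1 + K : ℝ≥0) : ℝ≥0∞) ^ d * ∫⁻ x, f x := by
  have hp : ∀ x, ((ℝ ∙ e)ᗮ.orthogonalProjectionOnto x : E) = x - inner ℝ e x • e := by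
    intro x
    rw [← Submodule.starProjection_apply, Submodule.starProjection_orthogonal_val,
      Submodule.starProjection_unit_singleton ℝ he]
  have hPm : Measurable (ℝ ∙ e)ᗮ.orthogonalProjectionOnto :=
    (ℝ ∙ e)ᗮ.orthogonalProjectionOnto.continuous.measurable
  have hm : Measurable fun y : (ℝ ∙ e)ᗮ => ∫⁻ t : ℝ, f (y + t • e) := by
    have : Measurable fun p : (ℝ ∙ e)ᗮ × ℝ => f (p.1 + p.2 • e) := hf.comp (by fun_prop)
    exact this.lintegral_prod_right'
  have hx : ∀ x, ∫⁻ t : ℝ, f (x + t • e) =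
      ∫⁻ t : ℝ, f ((ℝ ∙ e)ᗮ.orthogonalProjectionOnto x + t • e) := by
    intro x
    rw [← lintegral_add_right_eq_self
      (fun t : ℝ => f ((ℝ ∙ e)ᗮ.orthogonalProjectionOnto x + t • e)) (inner ℝ e x)]
    refine lintegral_congr fun t => ?_
    rw [hp]
    congr 1
    module
  rw [lintegral_congr hx,
    ← lintegral_map hm hPm, lintegral_eq_lintegral_orthogonal_lintegral he hf,
    ← smul_eq_mul, ← lintegral_smul_measure]
  exact lintegral_mono' (map_surfaceMeasure_graph_le hd he hh hSh) le_rfl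

theorem surfaceMeasure_graph_lt_top {d : ℕ} (hd : Module.finrank ℝ E = d + 1) (he : ‖e‖ = 1)
    (hh : LipschitzWith K h) (hSb : Bornology.IsBounded S)
    (hSh : ∀ x ∈ S, h (x - inner ℝ e x • e) = inner ℝ e x) : μHE[d] S < ⊤ := by
  have hPm : Measurable (ℝ ∙ e)ᗮ.orthogonalProjectionOnto :=
    (ℝ ∙ e)ᗮ.orthogonalProjectionOnto.continuous.measurable
  obtain ⟨R, hR⟩ := hSb.subset_closedBall 0
  have h1 := map_surfaceMeasure_graph_le hd he hh hSh (Metric.closedBall 0 R)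
  rw [Measure.map_apply hPm measurableSet_closedBall,
    Measure.restrict_apply (hPm measurableSet_closedBall)] at h1
  refine lt_of_le_of_lt ((measure_mono ?_).trans h1) ?_
  · refine fun x hx => ⟨?_, hx⟩
    have hx' := hR hx
    simp only [Set.mem_preimage, mem_closedBall_zero_iff] at hx' ⊢
    exact (Submodule.norm_orthogonalProjectionOnto_apply_le _ _).trans hx'
  · rw [Measure.smul_apply, smul_eq_mul]
    exact ENNReal.mul_lt_top (by finiteness) measure_closedBall_lt_top

end LipschitzGraphs

/-! ### Lipschitz domains -/

section LipschitzDomains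

variable {n : ℕ} {Ω : Set (RSpace n)}

theorem le_of_mem_closure_of_epigraph {x₀ e x : RSpace n} {r : ℝ} {h : RSpace n → ℝ}
    (hh : Continuous h)
    (hΩ : ∀ x ∈ Metric.ball x₀ r, x ∈ Ω ↔ h (x - inner ℝ e x • e) < inner ℝ e x)
    (hx : x ∈ closure Ω) (hxr : x ∈ Metric.ball x₀ r) :
    h (x - inner ℝ e x • e) ≤ inner ℝ e x := by
  by_contra! hlt
  have ho : IsOpen {z : RSpace n | inner ℝ e z < h (z - inner ℝ e z • e)} :=
    isOpen_lt (by fun_prop) (by fun_prop)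
  obtain ⟨z, ⟨hz1, hz2⟩, hzΩ⟩ := mem_closure_iff.1 hx _ (ho.inter Metric.isOpen_ball) ⟨hlt, hxr⟩
  exact lt_asymm hz1 ((hΩ z hz2).1 hzΩ)

theorem eq_of_mem_frontier_of_epigraph {x₀ e x : RSpace n} {r : ℝ} {h : RSpace n → ℝ}
    (hh : Continuous h) (hΩo : IsOpen Ω)
    (hΩ : ∀ x ∈ Metric.ball x₀ r, x ∈ Ω ↔ h (x - inner ℝ e x • e) < inner ℝ e x)
    (hx : x ∈ frontier Ω) (hxr : x ∈ Metric.ball x₀ r) :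
    h (x - inner ℝ e x • e) = inner ℝ e x := by
  refine le_antisymm (le_of_mem_closure_of_epigraph hh hΩ (frontier_subset_closure hx) hxr) ?_
  rw [hΩo.frontier_eq] at hx
  exact not_lt.1 fun hlt => hx.2 ((hΩ x hxr).2 hlt)

theorem norm_sub_inner_smul_le {e : RSpace n} (he : ‖e‖ = 1) (x : RSpace n) :
    ‖x - inner ℝ e x • e‖ ≤ ‖x‖ := by
  have h := Submodule.norm_orthogonalProjectionOnto_apply_le (ℝ ∙ e)ᗮ x
  rwa [Submodule.coe_norm, ← Submodule.starProjection_apply,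
    Submodule.starProjection_orthogonal_val, Submodule.starProjection_unit_singleton ℝ he] at h

/-- Near a boundary point, both `Ω` and its boundary are linked through `Ω` to a ball inside `Ω`:
flow upwards in the direction of the vertical axis of a local graph. -/
theorem exists_nhds_poincarePair_ball (hΩo : IsOpen Ω) (hΩ : HasLipschitzBoundary Ω)
    {x₀ : RSpace n} (hx₀ : x₀ ∈ frontier Ω) :
    ∃ N ∈ 𝓝 x₀, ∃ (c : RSpace n) (s : ℝ), 0 < s ∧ Metric.ball c s ⊆ Ω ∧
      surfaceMeasure n (N ∩ frontier Ω) < ⊤ ∧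
      PoincarePair Ω (volume.restrict (N ∩ Ω)) (volume.restrict (Metric.ball c s)) ∧
      PoincarePair Ω ((surfaceMeasure n).restrict (N ∩ frontier Ω))
        (volume.restrict (Metric.ball c s)) := by
  obtain ⟨e, r, K, h, he, hr, hh, hepi⟩ := hΩ x₀ hx₀
  have hn : Module.finrank ℝ (RSpace n) = (n - 1) + 1 := by
    rw [finrank_euclideanSpace_fin]
    rcases n with _ | n
    · have : e = 0 := Subsingleton.elim _ _
      simp [this] at he
    · rfl
  have hee : inner ℝ e e = (1 : ℝ) := by rw [real_inner_self_eq_norm_sq, he, one_pow]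
  have hshift : ∀ (x : RSpace n) (t : ℝ),
      x + t • e - inner ℝ e (x + t • e) • e = x - inner ℝ e x • e := by
    intro x t
    rw [inner_add_right, inner_smul_right, hee]
    module
  have hinner : ∀ (x : RSpace n) (t : ℝ), inner ℝ e (x + t • e) = inner ℝ e x + t := by
    intro x t
    rw [inner_add_right, inner_smul_right, hee, mul_one]
  obtain ⟨L, hL⟩ : ∃ L, L = r / 2 := ⟨_, rfl⟩
  -- The flow time `L` exceeds the vertical extent `2 * ρ * (K + 1)` of the graph over the target
  -- ball, and the whole construction stays in the ball of radius `r`.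
  obtain ⟨ρ, hρ0, hρL, hρr⟩ : ∃ ρ, 0 < ρ ∧ 2 * ρ * (K + 1) < L ∧ L + 2 * ρ < r := by
    have hK : (0 : ℝ) ≤ K := K.coe_nonneg
    refine ⟨r / (8 * (K + 1)), by positivity, ?_, ?_⟩
    · have : 2 * (r / (8 * ((K : ℝ) + 1))) * (K + 1) = r / 4 := by field_simp; norm_num
      linarith
    · have : r / (8 * ((K : ℝ) + 1)) ≤ r / 8 := by gcongr; linarith
      linarith
  have hL0 : 0 < L := by linarith
  have hKρ : 0 ≤ 2 * ρ * K := by positivity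
  have hup : ∀ x ∈ closure Ω ∩ Metric.ball x₀ ρ, ∀ t ∈ Set.Ioc 0 L, x + t • e ∈ Ω := by
    rintro x ⟨hx, hxρ⟩ t ht
    have hxr : x ∈ Metric.ball x₀ r := Metric.ball_subset_ball (by linarith) hxρ
    have hmem : x + t • e ∈ Metric.ball x₀ r := by
      rw [Metric.mem_ball, dist_eq_norm] at hxρ ⊢
      have : ‖x + t • e - x₀‖ ≤ ‖x - x₀‖ + ‖t • e‖ := by
        rw [add_sub_right_comm]
        exact norm_add_le _ _
      rw [norm_smul, he, mul_one, Real.norm_eq_abs, abs_of_pos ht.1] at this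
      linarith [ht.2]
    rw [hepi _ hmem, hshift, hinner]
    linarith [le_of_mem_closure_of_epigraph hh.continuous hepi hx hxr, ht.1]
  have htarget : ∀ x ∈ Metric.ball x₀ ρ, ∀ t ∈ Set.Ioc (L - ρ) L,
      x + t • e ∈ Metric.ball (x₀ + L • e) (2 * ρ) := by
    intro x hxρ t ht
    rw [Metric.mem_ball, dist_eq_norm] at hxρ ⊢
    have : ‖x + t • e - (x₀ + L • e)‖ ≤ ‖x - x₀‖ + ‖(t - L) • e‖ := by
      rw [sub_smul, add_sub_add_comm]
      exact norm_add_le _ _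
    rw [norm_smul, he, mul_one, Real.norm_eq_abs, abs_of_nonpos (by linarith [ht.2])] at this
    linarith [ht.1]
  have hball : Metric.ball (x₀ + L • e) (2 * ρ) ⊆ Ω := by
    intro z hz
    obtain ⟨w, rfl⟩ : ∃ w, z = x₀ + w + L • e := ⟨z - L • e - x₀, by module⟩
    have hw : ‖w‖ < 2 * ρ := by
      rw [Metric.mem_ball, dist_eq_norm] at hz
      rwa [show x₀ + w + L • e - (x₀ + L • e) = w by module] at hz
    have hmem : x₀ + w + L • e ∈ Metric.ball x₀ r := by
      rw [Metric.mem_ball, dist_eq_norm, show x₀ + w + L • e - x₀ = w + L • e by module]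
      refine (norm_add_le _ _).trans_lt ?_
      rw [norm_smul, he, mul_one, Real.norm_eq_abs, abs_of_pos hL0]
      linarith
    rw [hepi _ hmem, hshift, hinner, inner_add_right]
    have h0 := eq_of_mem_frontier_of_epigraph hh.continuous hΩo hepi hx₀ (Metric.mem_ball_self hr)
    have h1 : h (x₀ + w - (inner ℝ e x₀ + inner ℝ e w) • e) ≤
        h (x₀ - inner ℝ e x₀ • e) + K * ‖w‖ := by
      have h2 := hh.le_add_mul (x₀ + w - (inner ℝ e x₀ + inner ℝ e w) • e)
        (x₀ - inner ℝ e x₀ • e)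
      rw [dist_eq_norm, show x₀ + w - (inner ℝ e x₀ + inner ℝ e w) • e -
        (x₀ - inner ℝ e x₀ • e) = w - inner ℝ e w • e by module] at h2
      have := mul_le_mul_of_nonneg_left (norm_sub_inner_smul_le he w) K.coe_nonneg
      linarith
    have h3 : -‖w‖ ≤ inner ℝ e w := by
      have := abs_real_inner_le_norm e w
      rw [he, one_mul] at this
      exact (abs_le.1 this).1
    have h4 : (K : ℝ) * ‖w‖ ≤ K * (2 * ρ) := by gcongr
    linarith
  have hgraph : ∀ x ∈ Metric.ball x₀ ρ ∩ frontier Ω,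
      h (x - inner ℝ e x • e) = inner ℝ e x := fun x hx =>
    eq_of_mem_frontier_of_epigraph hh.continuous hΩo hepi hx.2
      (Metric.ball_subset_ball (by linarith) hx.1)
  have hfin : surfaceMeasure n (Metric.ball x₀ ρ ∩ frontier Ω) < ⊤ :=
    surfaceMeasure_graph_lt_top hn he hh
      (Metric.isBounded_ball.subset Set.inter_subset_left) hgraph
  have hB : PoincarePair Ω (volume.restrict (Metric.ball (x₀ + L • e) (2 * ρ)))
      (volume.restrict (Metric.ball (x₀ + L • e) (2 * ρ))) :=
    ((convex_ball _ _).poincarePair measurableSet_ball Metric.isBounded_ball).mono hball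
      le_rfl le_rfl
  refine ⟨Metric.ball x₀ ρ, Metric.ball_mem_nhds _ hρ0, x₀ + L • e, 2 * ρ, by positivity, hball,
    hfin, ?_, ?_⟩
  · have : IsFiniteMeasure (volume.restrict (Metric.ball x₀ ρ ∩ Ω)) :=
      isFiniteMeasure_restrict.2
        ((measure_mono Set.inter_subset_left).trans_lt measure_ball_lt_top).ne
    refine PoincarePair.of_flow (S := Metric.ball x₀ ρ ∩ Ω) (e := e) (a := L - ρ) (L := L)
      (C := L.toNNReal) hΩo.measurableSet measurableSet_ball measure_ball_lt_top.ne
      (ae_restrict_mem (measurableSet_ball.inter hΩo.measurableSet)) (by linarith) (by linarith)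
      ?_ (fun x hx => hup x ⟨subset_closure hx.2, hx.1⟩) (fun x hx => htarget x hx.1) hB
    intro f hf
    rw [lintegral_lintegral_swap
      (by fun_prop : Measurable fun p : RSpace n × ℝ => f (p.1 + p.2 • e)).aemeasurable]
    calc ∫⁻ t in Set.Ioc 0 L, ∫⁻ x in Metric.ball x₀ ρ ∩ Ω, f (x + t • e)
        ≤ ∫⁻ t in Set.Ioc 0 L, ∫⁻ x, f x := lintegral_mono fun t =>
          (setLIntegral_le_lintegral _ _).trans (lintegral_add_right_eq_self f _).le
      _ = _ := by
          rw [setLIntegral_const, Real.volume_Ioc, sub_zero, mul_comm]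
          rfl
  · have : IsFiniteMeasure ((surfaceMeasure n).restrict (Metric.ball x₀ ρ ∩ frontier Ω)) :=
      isFiniteMeasure_restrict.2 hfin.ne
    refine PoincarePair.of_flow (S := Metric.ball x₀ ρ ∩ frontier Ω) (e := e) (a := L - ρ)
      (L := L) (C := (1 + K) ^ (n - 1)) hΩo.measurableSet measurableSet_ball
      measure_ball_lt_top.ne
      (ae_restrict_mem (measurableSet_ball.inter isClosed_frontier.measurableSet))
      (by linarith) (by linarith) ?_
      (fun x hx => hup x ⟨frontier_subset_closure hx.2, hx.1⟩) (fun x hx => htarget x hx.1) hB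
    intro f hf
    refine le_trans (lintegral_mono fun x => setLIntegral_le_lintegral _ _) ?_
    have := lintegral_graph_lintegral_le hn he hh hgraph hf
    rwa [ENNReal.coe_pow]

/-- A bounded connected Lipschitz domain satisfies the Poincaré inequality, its boundary has
finite surface measure, and the oscillation between boundary and interior is controlled by the
Dirichlet energy. -/
theorem poincarePair_of_hasLipschitzBoundary (hΩo : IsOpen Ω) (hΩc : IsConnected Ω)
    (hΩb : Bornology.IsBounded Ω) (hΩ : HasLipschitzBoundary Ω) :
    surfaceMeasure n (frontier Ω) < ⊤ ∧
      PoincarePair Ω (volume.restrict Ω) (volume.restrict Ω) ∧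
      PoincarePair Ω ((surfaceMeasure n).restrict (frontier Ω)) (volume.restrict Ω) := by
  obtain ⟨x₁, hx₁⟩ := hΩc.nonempty
  obtain ⟨r₁, hr₁, hball₁⟩ := Metric.isOpen_iff.1 hΩo x₁ hx₁
  obtain ⟨ν, hν⟩ : ∃ ν : Measure (RSpace n), ν = volume.restrict (Metric.ball x₁ r₁) := ⟨_, rfl⟩
  have hfν : IsFiniteMeasure ν := hν ▸ isFiniteMeasure_restrict.2 measure_ball_lt_top.ne
  have hnν : NeZero ν :=
    ⟨hν ▸ Measure.restrict_eq_zero.not.2 (Metric.measure_ball_pos volume x₁ hr₁).ne'⟩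
  have hfΩ : IsFiniteMeasure (volume.restrict Ω) :=
    isFiniteMeasure_restrict.2 hΩb.measure_lt_top.ne
  have hfin : ∀ N, IsFiniteMeasure (volume.restrict (N ∩ Ω)) := fun N =>
    isFiniteMeasure_restrict.2
      ((measure_mono Set.inter_subset_right).trans_lt hΩb.measure_lt_top).ne
  have key : surfaceMeasure n (closure Ω ∩ frontier Ω) < ⊤ ∧
      PoincarePair Ω (volume.restrict (closure Ω ∩ Ω)) ν ∧
      PoincarePair Ω ((surfaceMeasure n).restrict (closure Ω ∩ frontier Ω)) ν := by
    refine hΩb.isCompact_closure.induction_on (p := fun N =>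
      surfaceMeasure n (N ∩ frontier Ω) < ⊤ ∧ PoincarePair Ω (volume.restrict (N ∩ Ω)) ν ∧
      PoincarePair Ω ((surfaceMeasure n).restrict (N ∩ frontier Ω)) ν) ?_ ?_ ?_ ?_
    · simp [PoincarePair.zero_left]
    · rintro N N' hN ⟨h1, h2, h3⟩
      exact ⟨(measure_mono (Set.inter_subset_inter_left _ hN)).trans_lt h1,
        h2.mono le_rfl (Measure.restrict_mono (Set.inter_subset_inter_left _ hN) le_rfl) le_rfl,
        h3.mono le_rfl (Measure.restrict_mono (Set.inter_subset_inter_left _ hN) le_rfl) le_rfl⟩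
    · rintro N N' ⟨h1, h2, h3⟩ ⟨h1', h2', h3'⟩
      simp only [Set.union_inter_distrib_right]
      exact ⟨measure_union_lt_top h1 h1',
        (h2.add_left h2').mono le_rfl (Measure.restrict_union_le _ _) le_rfl,
        (h3.add_left h3').mono le_rfl (Measure.restrict_union_le _ _) le_rfl⟩
    · intro x hx
      by_cases hxΩ : x ∈ Ω
      · obtain ⟨s, hs, hsΩ⟩ := Metric.isOpen_iff.1 hΩo x hxΩ
        refine ⟨Metric.ball x s, mem_nhdsWithin_of_mem_nhds (Metric.ball_mem_nhds x hs), ?_⟩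
        have hempty : Metric.ball x s ∩ frontier Ω = ∅ := by
          rw [hΩo.frontier_eq]
          exact Set.disjoint_iff_inter_eq_empty.1
            (Set.disjoint_left.2 fun z hz hz' => hz'.2 (hsΩ hz))
        rw [hempty, Measure.restrict_empty, Set.inter_eq_left.2 hsΩ, measure_empty, hν]
        exact ⟨ENNReal.zero_lt_top,
          hΩc.isPreconnected.poincarePair_ball hΩo hs hr₁ hsΩ hball₁,
          PoincarePair.zero_left _ _⟩
      · have hxf : x ∈ frontier Ω := by
          rw [hΩo.frontier_eq]
          exact ⟨hx, hxΩ⟩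
        obtain ⟨N, hN, c, s, hs, hsΩ, h1, h2, h3⟩ := exists_nhds_poincarePair_ball hΩo hΩ hxf
        have hb := hΩc.isPreconnected.poincarePair_ball hΩo hs hr₁ hsΩ hball₁
        rw [← hν] at hb
        have : IsFiniteMeasure (volume.restrict (Metric.ball c s)) :=
          isFiniteMeasure_restrict.2 measure_ball_lt_top.ne
        have : NeZero (volume.restrict (Metric.ball c s)) :=
          ⟨Measure.restrict_eq_zero.not.2 (Metric.measure_ball_pos volume c hs).ne'⟩
        have : IsFiniteMeasure ((surfaceMeasure n).restrict (N ∩ frontier Ω)) :=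
          isFiniteMeasure_restrict.2 h1.ne
        exact ⟨N, mem_nhdsWithin_of_mem_nhds hN, h1, h2.trans hb, h3.trans hb⟩
  rw [Set.inter_eq_right.2 frontier_subset_closure, Set.inter_eq_right.2 subset_closure] at key
  obtain ⟨h1, h2, h3⟩ := key
  have : IsFiniteMeasure ((surfaceMeasure n).restrict (frontier Ω)) :=
    isFiniteMeasure_restrict.2 h1.ne
  exact ⟨h1, h2.trans h2.symm, h3.trans h2.symm⟩

end LipschitzDomains

/-! ### The Hilbert space of functions with a trace -/

section TraceSpaces

/-- If `μ` and `ν` are linked through `Ω`, then the mean square on `μ` is controlled by the one on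
`ν` and the Dirichlet energy: for `μ` on the boundary and `ν` on `Ω` this is a trace inequality, and
for `μ` on `Ω` and `ν` on the boundary a Poincaré inequality. -/
theorem PoincarePair.exists_lintegral_sq_le {E : Type*} [NormedAddCommGroup E]
    [InnerProductSpace ℝ E] [FiniteDimensional ℝ E] [MeasurableSpace E] [BorelSpace E] {Ω : Set E}
    {μ ν : Measure E} [IsFiniteMeasure μ] [IsFiniteMeasure ν] [NeZero ν]
    (h : PoincarePair Ω μ ν) :
    ∃ K : ℝ≥0, ∀ φ : E → ℝ, ContDiff ℝ 1 φ → ∫⁻ x, ‖φ x‖ₑ ^ 2 ∂μ ≤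
      K * ((∫⁻ x in Ω, ‖fderiv ℝ φ x‖ₑ ^ 2) + ∫⁻ x, ‖φ x‖ₑ ^ 2 ∂ν) := by
  obtain ⟨C, hC⟩ := h
  have hν0 : ν Set.univ ≠ 0 := by simpa using NeZero.ne ν
  have hνt : ν Set.univ ≠ ⊤ := measure_ne_top _ _
  have hμt : μ Set.univ ≠ ⊤ := measure_ne_top _ _
  obtain ⟨K, hK⟩ : ∃ K : ℝ≥0∞, K = (ν Set.univ)⁻¹ * (2 * C + 2 * μ Set.univ) := ⟨_, rfl⟩
  have hKt : K ≠ ⊤ := by rw [hK]; finiteness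
  refine ⟨K.toNNReal, fun φ hφ => ?_⟩
  rw [ENNReal.coe_toNNReal hKt, hK, mul_assoc, ← ENNReal.div_eq_inv_mul,
    ENNReal.le_div_iff_mul_le (Or.inl hν0) (Or.inl hνt)]
  have hc := hφ.continuous
  have hm := measurable_enorm_sub_sq hφ
  have hm1 : ∀ x, Measurable fun y => ‖φ x - φ y‖ₑ ^ 2 := fun x =>
    (by fun_prop : Continuous fun y => ‖φ x - φ y‖ₑ ^ 2).measurable
  have hms : Measurable fun y => ‖φ y‖ₑ ^ 2 :=
    (by fun_prop : Continuous fun y => ‖φ y‖ₑ ^ 2).measurable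
  have hi : Measurable fun x => ∫⁻ y, ‖φ x - φ y‖ₑ ^ 2 ∂ν := hm.lintegral_prod_right'
  have hpt : ∀ x, ‖φ x‖ₑ ^ 2 * ν Set.univ ≤
      2 * (∫⁻ y, ‖φ x - φ y‖ₑ ^ 2 ∂ν) + 2 * ∫⁻ y, ‖φ y‖ₑ ^ 2 ∂ν := by
    intro x
    rw [← lintegral_const, ← lintegral_const_mul _ (hm1 x), ← lintegral_const_mul _ hms,
      ← lintegral_add_left ((hm1 x).const_mul 2)]
    refine lintegral_mono fun y => ?_
    simpa using enorm_sub_sq_le_two_mul (φ x) 0 (φ y)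
  rw [← lintegral_mul_const _ hms]
  refine (lintegral_mono hpt).trans ?_
  rw [lintegral_add_right _ measurable_const, lintegral_const, lintegral_const_mul _ hi]
  calc 2 * (∫⁻ x, ∫⁻ y, ‖φ x - φ y‖ₑ ^ 2 ∂ν ∂μ) + 2 * (∫⁻ y, ‖φ y‖ₑ ^ 2 ∂ν) * μ Set.univ
      ≤ 2 * (C * ∫⁻ x in Ω, ‖fderiv ℝ φ x‖ₑ ^ 2) + 2 * (∫⁻ y, ‖φ y‖ₑ ^ 2 ∂ν) * μ Set.univ :=
        add_le_add_left (mul_le_mul_right (hC φ hφ) _) _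
    _ = 2 * C * (∫⁻ x in Ω, ‖fderiv ℝ φ x‖ₑ ^ 2) + 2 * μ Set.univ * ∫⁻ y, ‖φ y‖ₑ ^ 2 ∂ν := by
        ring
    _ ≤ (2 * C + 2 * μ Set.univ) * (∫⁻ x in Ω, ‖fderiv ℝ φ x‖ₑ ^ 2) +
          (2 * C + 2 * μ Set.univ) * ∫⁻ y, ‖φ y‖ₑ ^ 2 ∂ν :=
        add_le_add (mul_le_mul_left le_self_add _) (mul_le_mul_left le_add_self _)
    _ = _ := by ring

theorem enorm_sq_eq_lintegral_of_ae_eq {X F : Type*} [MeasurableSpace X] {μ : Measure X}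
    [NormedAddCommGroup F] (f : Lp F 2 μ) {φ : X → F} (h : f =ᵐ[μ] φ) :
    ‖f‖ₑ ^ 2 = ∫⁻ x, ‖φ x‖ₑ ^ 2 ∂μ := by
  rw [Lp.enorm_def, eLpNorm_congr_ae h]
  have := eLpNorm_nnreal_pow_eq_lintegral (μ := μ) (f := φ) (p := 2) two_ne_zero
  simpa [ENNReal.rpow_ofNat] using this

theorem norm_sq_le_of_enorm_sq_le {F G H : Type*} [SeminormedAddCommGroup F]
    [SeminormedAddCommGroup G] [SeminormedAddCommGroup H] {f : F} {g : G} {h : H} {K : ℝ≥0}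
    (hle : ‖f‖ₑ ^ 2 ≤ K * (‖g‖ₑ ^ 2 + ‖h‖ₑ ^ 2)) :
    ‖f‖ ^ 2 ≤ K * (‖g‖ ^ 2 + ‖h‖ ^ 2) := by
  simp only [enorm_eq_nnnorm] at hle
  exact_mod_cast hle

theorem norm_gradient {E : Type*} [NormedAddCommGroup E] [InnerProductSpace ℝ E] [CompleteSpace E]
    (φ : E → ℝ) (x : E) : ‖gradient φ x‖ = ‖fderiv ℝ φ x‖ :=
  LinearIsometryEquiv.norm_map _ _

theorem continuous_gradient {E : Type*} [NormedAddCommGroup E] [InnerProductSpace ℝ E]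
    [CompleteSpace E] {φ : E → ℝ} (hφ : ContDiff ℝ 1 φ) : Continuous (gradient φ) :=
  (LinearIsometryEquiv.continuous _).comp (hφ.continuous_fderiv one_ne_zero)

theorem memLp_restrict_of_continuous {X F : Type*} [TopologicalSpace X] [MeasurableSpace X]
    [OpensMeasurableSpace X] [SecondCountableTopology X] [NormedAddCommGroup F] {μ : Measure X}
    {S : Set X} {f : X → F} (hf : Continuous f)
    (hS : IsCompact (closure S)) (hSm : MeasurableSet S) (hμ : μ S < ⊤) (p : ℝ≥0∞) :
    MemLp f p (μ.restrict S) := by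
  have : IsFiniteMeasure (μ.restrict S) := isFiniteMeasure_restrict.2 hμ.ne
  obtain ⟨C, hC⟩ := hS.exists_bound_of_continuousOn hf.continuousOn
  exact MemLp.of_bound hf.aestronglyMeasurable C
    ((ae_restrict_mem hSm).mono fun x hx => hC x (subset_closure hx))

/-- The space in which functions of `H¹(Ω)` with a trace live, as triples of the function, its
gradient and its trace; a Hilbert space. -/
abbrev TraceSpace {n : ℕ} (Ω : Set (RSpace n)) :=
  WithLp 2 (L2Dom Ω × WithLp 2 (L2Field Ω × L2Bdry (frontier Ω)))

namespace TraceSpace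

variable {n : ℕ} (Ω : Set (RSpace n))

/-- The function underlying a triple. -/
noncomputable def fnL : TraceSpace Ω →L[ℝ] L2Dom Ω := WithLp.fstL 2 ℝ _ _

/-- The gradient component of a triple. -/
noncomputable def gradL : TraceSpace Ω →L[ℝ] L2Field Ω :=
  (WithLp.fstL 2 ℝ _ _).comp (WithLp.sndL 2 ℝ _ _)

/-- The trace component of a triple. -/
noncomputable def traceL : TraceSpace Ω →L[ℝ] L2Bdry (frontier Ω) :=
  (WithLp.sndL 2 ℝ _ _).comp (WithLp.sndL 2 ℝ _ _)

variable {Ω}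

/-- The triple formed by a function of `H¹(Ω)` and a candidate for its trace. -/
noncomputable def mk (u : SobolevH1 Ω) (w : L2Bdry (frontier Ω)) : TraceSpace Ω :=
  WithLp.toLp 2 (u.fn, WithLp.toLp 2 (u.grad, w))

@[simp] theorem fnL_mk (u : SobolevH1 Ω) (w : L2Bdry (frontier Ω)) : fnL Ω (mk u w) = u.fn := rfl

theorem norm_sq_eq (v : TraceSpace Ω) :
    ‖v‖ ^ 2 = ‖fnL Ω v‖ ^ 2 + (‖gradL Ω v‖ ^ 2 + ‖traceL Ω v‖ ^ 2) := by
  rw [WithLp.prod_norm_sq_eq_of_L2, WithLp.prod_norm_sq_eq_of_L2]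
  rfl

variable (Ω) in
/-- The triples coming from smooth functions on the whole space. -/
noncomputable def smooth : Submodule ℝ (TraceSpace Ω) where
  carrier := {v | ∃ φ : RSpace n → ℝ, ContDiff ℝ ∞ φ ∧ fnL Ω v =ᵐ[volume.restrict Ω] φ ∧
    gradL Ω v =ᵐ[volume.restrict Ω] gradient φ ∧
    traceL Ω v =ᵐ[(surfaceMeasure n).restrict (frontier Ω)] φ}
  zero_mem' := by
    refine ⟨0, contDiff_const, ?_, ?_, ?_⟩
    · rw [map_zero]
      exact Lp.coeFn_zero _ _ _
    · rw [map_zero]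
      refine (Lp.coeFn_zero _ _ _).trans (Eventually.of_forall fun x => ?_)
      simp [gradient]
    · rw [map_zero]
      exact Lp.coeFn_zero _ _ _
  add_mem' := by
    rintro v v' ⟨φ, hφ, h1, h2, h3⟩ ⟨φ', hφ', h1', h2', h3'⟩
    refine ⟨φ + φ', hφ.add hφ', ?_, ?_, ?_⟩
    · rw [map_add]
      exact (Lp.coeFn_add _ _).trans (h1.add h1')
    · rw [map_add]
      refine ((Lp.coeFn_add _ _).trans (h2.add h2')).trans (Eventually.of_forall fun x => ?_)
      simp only [gradient, Pi.add_apply]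
      rw [fderiv_add (hφ.differentiable (by simp) x) (hφ'.differentiable (by simp) x), map_add]
    · rw [map_add]
      exact (Lp.coeFn_add _ _).trans (h3.add h3')
  smul_mem' := by
    rintro c v ⟨φ, hφ, h1, h2, h3⟩
    refine ⟨c • φ, contDiff_const.smul hφ, ?_, ?_, ?_⟩
    · rw [map_smul]
      exact (Lp.coeFn_smul _ _).trans (h1.const_smul c)
    · rw [map_smul]
      refine ((Lp.coeFn_smul _ _).trans (h2.const_smul c)).trans (Eventually.of_forall fun x => ?_)
      simp only [gradient, Pi.smul_apply]
      rw [fderiv_const_smul (hφ.differentiable (by simp) x), map_smul]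
    · rw [map_smul]
      exact (Lp.coeFn_smul _ _).trans (h3.const_smul c)

/-- Having a trace means being a limit of triples of smooth functions. -/
theorem mk_mem_closure_smooth_iff (hΩo : IsOpen Ω) (hΩb : Bornology.IsBounded Ω)
    (hfin : surfaceMeasure n (frontier Ω) < ⊤) (u : SobolevH1 Ω) (w : L2Bdry (frontier Ω)) :
    mk u w ∈ (smooth Ω).topologicalClosure ↔ HasTrace u w := by
  have hcl : IsCompact (closure (frontier Ω)) := by
    rw [isClosed_frontier.closure_eq]
    exact hΩb.isCompact_closure.of_isClosed_subset isClosed_frontier frontier_subset_closure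
  rw [← SetLike.mem_coe, Submodule.topologicalClosure_coe, mem_closure_iff_seq_limit]
  constructor
  · rintro ⟨v, hv, hlim⟩
    choose φ hφ h1 h2 h3 using hv
    refine ⟨φ, hφ, ?_, ?_, ?_⟩
    · have := (Lp.tendsto_Lp_iff_tendsto_eLpNorm' _ _).1 (((fnL Ω).continuous.tendsto _).comp hlim)
      refine this.congr fun k => eLpNorm_congr_ae ?_
      exact (h1 k).sub (ae_eq_refl _)
    · have := (Lp.tendsto_Lp_iff_tendsto_eLpNorm' _ _).1
        (((gradL Ω).continuous.tendsto _).comp hlim)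
      refine this.congr fun k => eLpNorm_congr_ae ?_
      exact (h2 k).sub (ae_eq_refl _)
    · have := (Lp.tendsto_Lp_iff_tendsto_eLpNorm' _ _).1
        (((traceL Ω).continuous.tendsto _).comp hlim)
      refine this.congr fun k => eLpNorm_congr_ae ?_
      exact (h3 k).sub (ae_eq_refl _)
  · rintro ⟨φ, hφ, h1, h2, h3⟩
    have hm1 : ∀ k, MemLp (φ k) 2 (volume.restrict Ω) := fun k =>
      memLp_restrict_of_continuous (hφ k).continuous hΩb.isCompact_closure hΩo.measurableSet
        hΩb.measure_lt_top 2
    have hm2 : ∀ k, MemLp (gradient (φ k)) 2 (volume.restrict Ω) := fun k =>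
      memLp_restrict_of_continuous (continuous_gradient ((hφ k).of_le (by simp)))
        hΩb.isCompact_closure hΩo.measurableSet hΩb.measure_lt_top 2
    have hm3 : ∀ k, MemLp (φ k) 2 ((surfaceMeasure n).restrict (frontier Ω)) := fun k =>
      memLp_restrict_of_continuous (hφ k).continuous hcl isClosed_frontier.measurableSet hfin 2
    refine ⟨fun k => WithLp.toLp 2 ((hm1 k).toLp _, WithLp.toLp 2 ((hm2 k).toLp _, (hm3 k).toLp _)),
      fun k => ⟨φ k, hφ k, (hm1 k).coeFn_toLp, (hm2 k).coeFn_toLp, (hm3 k).coeFn_toLp⟩, ?_⟩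
    refine ((WithLp.prod_continuous_toLp 2 _ _).tendsto _).comp (Tendsto.prodMk_nhds ?_
      (((WithLp.prod_continuous_toLp 2 _ _).tendsto _).comp (Tendsto.prodMk_nhds ?_ ?_)))
    · refine (Lp.tendsto_Lp_iff_tendsto_eLpNorm' _ _).2 (h1.congr fun k => eLpNorm_congr_ae ?_)
      exact ((hm1 k).coeFn_toLp.sub (ae_eq_refl _)).symm
    · refine (Lp.tendsto_Lp_iff_tendsto_eLpNorm' _ _).2 (h2.congr fun k => eLpNorm_congr_ae ?_)
      exact ((hm2 k).coeFn_toLp.sub (ae_eq_refl _)).symm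
    · refine (Lp.tendsto_Lp_iff_tendsto_eLpNorm' _ _).2 (h3.congr fun k => eLpNorm_congr_ae ?_)
      exact ((hm3 k).coeFn_toLp.sub (ae_eq_refl _)).symm

end TraceSpace

end TraceSpaces

/-! ### Lax–Milgram theorem and coercivity -/

section TraceSpaces

/-- The Lax–Milgram theorem with an inhomogeneous constraint: the solution is sought in the
translate `u₀ + W` of a closed subspace `W` on which the form is coercive. -/
theorem existsUnique_of_coerciveOn {E : Type*} [NormedAddCommGroup E] [InnerProductSpace ℝ E]
    [CompleteSpace E] {W : Submodule ℝ E} (hW : IsClosed (W : Set E)) (A : E →L[ℝ] E →L[ℝ] ℝ)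
    {c : ℝ} (hc : 0 < c) (hA : ∀ v ∈ W, c * ‖v‖ ^ 2 ≤ A v v) (u₀ : E) (l : E →L[ℝ] ℝ) :
    ∃! u : E, u - u₀ ∈ W ∧ ∀ v ∈ W, A u v = l v := by
  have : CompleteSpace W := hW.completeSpace_coe
  have hco : IsCoercive (A.bilinearComp W.subtypeL W.subtypeL) := by
    refine ⟨c, hc, fun v => ?_⟩
    have := hA v v.2
    rwa [sq, ← mul_assoc] at this
  refine existsUnique_of_exists_of_unique ?_ ?_
  · obtain ⟨w, hw⟩ := hco.continuousLinearEquivOfBilin.surjective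
      ((InnerProductSpace.toDual ℝ W).symm ((l - A u₀).comp W.subtypeL))
    refine ⟨u₀ + w, by simp, fun v hv => ?_⟩
    have := hco.continuousLinearEquivOfBilin_apply w ⟨v, hv⟩
    rw [hw, InnerProductSpace.toDual_symm_apply] at this
    simp only [ContinuousLinearMap.comp_apply, sub_apply,
      ContinuousLinearMap.bilinearComp_apply, Submodule.subtypeL_apply] at this
    rw [map_add, add_apply, ← this]
    ring
  · rintro u u' ⟨hu, hAu⟩ ⟨hu', hAu'⟩
    have hd : u - u' ∈ W := by simpa using W.sub_mem hu hu'
    have h0 := hA _ hd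
    rw [map_sub A, sub_apply, hAu _ hd, hAu' _ hd, sub_self] at h0
    have : ‖u - u'‖ ^ 2 = 0 := le_antisymm (by nlinarith [sq_nonneg ‖u - u'‖]) (sq_nonneg _)
    exact sub_eq_zero.1 (norm_eq_zero.1 (pow_eq_zero_iff two_ne_zero |>.1 this))

theorem memLp_of_subset_bdry {n : ℕ} {Γ Γ' : Set (RSpace n)} (h : Γ ⊆ Γ') (f : L2Bdry Γ') :
    MemLp f 2 ((surfaceMeasure n).restrict Γ) :=
  (Lp.memLp f).mono_measure (Measure.restrict_mono h le_rfl)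

/-- Restriction of square integrable functions to a smaller part of the boundary. -/
noncomputable def restrictBdry {n : ℕ} {Γ Γ' : Set (RSpace n)} (h : Γ ⊆ Γ') :
    L2Bdry Γ' →L[ℝ] L2Bdry Γ :=
  LinearMap.mkContinuous
    { toFun := fun f => (memLp_of_subset_bdry h f).toLp f
      map_add' := fun f g => by
        rw [← MemLp.toLp_add]
        exact MemLp.toLp_congr _ _
          (ae_mono (Measure.restrict_mono h le_rfl) (Lp.coeFn_add f g))
      map_smul' := fun c f => by
        rw [RingHom.id_apply, ← MemLp.toLp_const_smul]
        exact MemLp.toLp_congr _ _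
          (ae_mono (Measure.restrict_mono h le_rfl) (Lp.coeFn_smul c f)) }
    1 fun f => by
      rw [one_mul]
      change ‖(memLp_of_subset_bdry h f).toLp f‖ ≤ _
      rw [Lp.norm_toLp, Lp.norm_def]
      exact ENNReal.toReal_mono (Lp.eLpNorm_ne_top f)
        (eLpNorm_mono_measure _ (Measure.restrict_mono h le_rfl))

theorem coeFn_restrictBdry {n : ℕ} {Γ Γ' : Set (RSpace n)} (h : Γ ⊆ Γ') (f : L2Bdry Γ') :
    restrictBdry h f =ᵐ[(surfaceMeasure n).restrict Γ] f :=
  (memLp_of_subset_bdry h f).coeFn_toLp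

theorem agreesOn_iff {n : ℕ} {Ω Γ : Set (RSpace n)} (h : Γ ⊆ frontier Ω)
    (w : L2Bdry (frontier Ω)) (b : L2Bdry Γ) : AgreesOn Γ w b ↔ restrictBdry h w = b := by
  rw [Lp.ext_iff]
  exact ⟨fun H => (coeFn_restrictBdry h w).trans H, fun H => (coeFn_restrictBdry h w).symm.trans H⟩

theorem integral_mul_eq_inner {X : Type*} [MeasurableSpace X] {μ : Measure X}
    (f g : Lp ℝ 2 μ) {f' g' : X → ℝ} (hf : f =ᵐ[μ] f') (hg : g =ᵐ[μ] g') :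
    ∫ x, f' x * g' x ∂μ = inner ℝ f g := by
  rw [L2.inner_def]
  refine integral_congr_ae ?_
  filter_upwards [hf, hg] with x h1 h2
  rw [h1, h2]
  simp [mul_comm]

namespace TraceSpace

variable {n : ℕ} {Ω : Set (RSpace n)}

/-- Testing a weak gradient against `φ` and `ξ` amounts to an orthogonality relation in `L²`. -/
theorem exists_inner_add_inner_eq_zero_iff {φ : RSpace n → ℝ} (hφ : ContDiff ℝ ∞ φ)
    (hc : HasCompactSupport φ) (ξ : RSpace n) :
    ∃ (p : L2Dom Ω) (P : L2Field Ω), ∀ (u : L2Dom Ω) (G : L2Field Ω),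
      (∫ x in Ω, u x * fderiv ℝ φ x ξ = - ∫ x in Ω, φ x * inner ℝ (G x) ξ) ↔
        inner ℝ p u + inner ℝ P G = 0 := by
  have h1 : MemLp (fun x => fderiv ℝ φ x ξ) 2 (volume.restrict Ω) :=
    Continuous.memLp_of_hasCompactSupport
      ((hφ.continuous_fderiv (by simp)).clm_apply continuous_const) (hc.fderiv_apply ℝ ξ)
  have h2 : MemLp (fun x => φ x • ξ) 2 (volume.restrict Ω) :=
    Continuous.memLp_of_hasCompactSupport (hφ.continuous.smul continuous_const) hc.smul_right
  refine ⟨h1.toLp _, h2.toLp _, fun u G => ?_⟩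
  have e1 : ∫ x in Ω, u x * fderiv ℝ φ x ξ = inner ℝ (h1.toLp _) u := by
    rw [← integral_mul_eq_inner _ _ h1.coeFn_toLp (ae_eq_refl _)]
    exact integral_congr_ae (Eventually.of_forall fun x => mul_comm _ _)
  have e2 : ∫ x in Ω, φ x * inner ℝ (G x) ξ = inner ℝ (h2.toLp _) G := by
    rw [L2.inner_def]
    refine integral_congr_ae ?_
    filter_upwards [h2.coeFn_toLp] with x hx
    rw [hx, inner_smul_left, real_inner_comm]
    rfl
  rw [e1, e2, eq_neg_iff_add_eq_zero]

variable (Ω) in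
/-- The triples whose second component is the weak gradient of the first. -/
noncomputable def weak : Submodule ℝ (TraceSpace Ω) where
  carrier := {v | IsWeakGradient Ω (fnL Ω v) (gradL Ω v)}
  zero_mem' := by
    intro φ hφ hc ht ξ
    obtain ⟨p, P, h⟩ := exists_inner_add_inner_eq_zero_iff (Ω := Ω) hφ hc ξ
    rw [h]
    simp
  add_mem' := by
    intro v v' hv hv' φ hφ hc ht ξ
    have h1 := hv φ hφ hc ht ξ
    have h2 := hv' φ hφ hc ht ξ
    obtain ⟨p, P, h⟩ := exists_inner_add_inner_eq_zero_iff (Ω := Ω) hφ hc ξ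
    rw [h] at h1 h2 ⊢
    rw [map_add, map_add, inner_add_right, inner_add_right]
    linarith
  smul_mem' := by
    intro c v hv φ hφ hc ht ξ
    have h1 := hv φ hφ hc ht ξ
    obtain ⟨p, P, h⟩ := exists_inner_add_inner_eq_zero_iff (Ω := Ω) hφ hc ξ
    rw [h] at h1 ⊢
    rw [map_smul, map_smul, inner_smul_right, inner_smul_right, ← mul_add, h1, mul_zero]

theorem isClosed_weak : IsClosed (weak Ω : Set (TraceSpace Ω)) := by
  have : (weak Ω : Set (TraceSpace Ω)) = {v | ∀ φ : RSpace n → ℝ, ContDiff ℝ ∞ φ →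
      HasCompactSupport φ → tsupport φ ⊆ Ω → ∀ ξ : RSpace n,
        ∫ x in Ω, fnL Ω v x * fderiv ℝ φ x ξ =
          - ∫ x in Ω, φ x * inner ℝ (gradL Ω v x) ξ} := rfl
  rw [this]
  simp only [Set.ofPred_forall]
  refine isClosed_iInter fun φ => isClosed_iInter fun hφ => isClosed_iInter fun hc =>
    isClosed_iInter fun _ => isClosed_iInter fun ξ => ?_
  obtain ⟨p, P, h⟩ := exists_inner_add_inner_eq_zero_iff (Ω := Ω) hφ hc ξ
  simp only [h]
  exact isClosed_eq (by fun_prop) continuous_const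

variable (Ω) in
/-- The functions of `H¹(Ω)` that have a trace, together with their gradient and trace. -/
noncomputable def traced : Submodule ℝ (TraceSpace Ω) := (smooth Ω).topologicalClosure ⊓ weak Ω

theorem isClosed_traced : IsClosed (traced Ω : Set (TraceSpace Ω)) :=
  (Submodule.isClosed_topologicalClosure _).inter isClosed_weak

theorem mk_mem_traced_iff (hΩo : IsOpen Ω) (hΩb : Bornology.IsBounded Ω)
    (hfin : surfaceMeasure n (frontier Ω) < ⊤) (u : SobolevH1 Ω) (w : L2Bdry (frontier Ω)) :
    mk u w ∈ traced Ω ↔ HasTrace u w :=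
  ⟨fun h => (mk_mem_closure_smooth_iff hΩo hΩb hfin u w).1 h.1,
    fun h => ⟨(mk_mem_closure_smooth_iff hΩo hΩb hfin u w).2 h, u.isWeakGradient⟩⟩

theorem exists_eq_mk {v : TraceSpace Ω} (hv : v ∈ traced Ω) :
    ∃ (u : SobolevH1 Ω) (w : L2Bdry (frontier Ω)), v = mk u w :=
  ⟨⟨fnL Ω v, gradL Ω v, hv.2⟩, traceL Ω v, rfl⟩

/-- The norm of a function with a trace is controlled by its gradient and by its trace on a
portion `Γ` of the boundary of positive surface measure. -/
theorem exists_norm_sq_le (hΩo : IsOpen Ω) (hΩc : IsConnected Ω)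
    (hΩb : Bornology.IsBounded Ω) (hΩ : HasLipschitzBoundary Ω) {Γ : Set (RSpace n)}
    (hΓ : Γ ⊆ frontier Ω) (hΓ0 : 0 < surfaceMeasure n Γ) :
    ∃ K : ℝ, 0 < K ∧ ∀ v ∈ traced Ω,
      ‖v‖ ^ 2 ≤ K * (‖gradL Ω v‖ ^ 2 + ‖restrictBdry hΓ (traceL Ω v)‖ ^ 2) := by
  obtain ⟨hfin, hPΩ, hPΓ⟩ := poincarePair_of_hasLipschitzBoundary hΩo hΩc hΩb hΩ
  have : IsFiniteMeasure (volume.restrict Ω) :=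
    isFiniteMeasure_restrict.2 hΩb.measure_lt_top.ne
  have : NeZero (volume.restrict Ω) :=
    ⟨Measure.restrict_eq_zero.not.2 (hΩo.measure_pos volume hΩc.nonempty).ne'⟩
  have : IsFiniteMeasure ((surfaceMeasure n).restrict (frontier Ω)) :=
    isFiniteMeasure_restrict.2 hfin.ne
  have : IsFiniteMeasure ((surfaceMeasure n).restrict Γ) :=
    isFiniteMeasure_restrict.2 ((measure_mono hΓ).trans_lt hfin).ne
  have : NeZero ((surfaceMeasure n).restrict Γ) :=
    ⟨Measure.restrict_eq_zero.not.2 hΓ0.ne'⟩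
  obtain ⟨K₁, h₁⟩ := hPΓ.exists_lintegral_sq_le
  obtain ⟨K₂, h₂⟩ := (hPΓ.mono le_rfl (Measure.restrict_mono hΓ le_rfl)
    le_rfl).symm.exists_lintegral_sq_le
  have hsmooth : ∀ v ∈ smooth Ω,
      ‖traceL Ω v‖ ^ 2 ≤ K₁ * (‖gradL Ω v‖ ^ 2 + ‖fnL Ω v‖ ^ 2) ∧
      ‖fnL Ω v‖ ^ 2 ≤ K₂ * (‖gradL Ω v‖ ^ 2 + ‖restrictBdry hΓ (traceL Ω v)‖ ^ 2) := by
    rintro v ⟨φ, hφ, hf, hg, ht⟩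
    have hφ1 : ContDiff ℝ 1 φ := hφ.of_le (by simp)
    have hg' : ‖gradL Ω v‖ₑ ^ 2 = ∫⁻ x in Ω, ‖fderiv ℝ φ x‖ₑ ^ 2 := by
      rw [enorm_sq_eq_lintegral_of_ae_eq _ hg]
      simp only [← ofReal_norm, norm_gradient]
    have hr : restrictBdry hΓ (traceL Ω v) =ᵐ[(surfaceMeasure n).restrict Γ] φ :=
      (coeFn_restrictBdry hΓ _).trans (ae_mono (Measure.restrict_mono hΓ le_rfl) ht)
    constructor
    · refine norm_sq_le_of_enorm_sq_le ?_
      rw [hg', enorm_sq_eq_lintegral_of_ae_eq _ hf, enorm_sq_eq_lintegral_of_ae_eq _ ht]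
      exact h₁ φ hφ1
    · refine norm_sq_le_of_enorm_sq_le ?_
      rw [hg', enorm_sq_eq_lintegral_of_ae_eq _ hf, enorm_sq_eq_lintegral_of_ae_eq _ hr]
      exact h₂ φ hφ1
  have hclosure : ∀ v ∈ (smooth Ω).topologicalClosure,
      ‖traceL Ω v‖ ^ 2 ≤ K₁ * (‖gradL Ω v‖ ^ 2 + ‖fnL Ω v‖ ^ 2) ∧
      ‖fnL Ω v‖ ^ 2 ≤ K₂ * (‖gradL Ω v‖ ^ 2 + ‖restrictBdry hΓ (traceL Ω v)‖ ^ 2) := by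
    intro v hv
    refine closure_minimal (s := (smooth Ω : Set (TraceSpace Ω))) hsmooth ?_ hv
    have hc1 : IsClosed {v : TraceSpace Ω |
        ‖traceL Ω v‖ ^ 2 ≤ K₁ * (‖gradL Ω v‖ ^ 2 + ‖fnL Ω v‖ ^ 2)} :=
      isClosed_le (by fun_prop) (by fun_prop)
    have hc2 : IsClosed {v : TraceSpace Ω |
        ‖fnL Ω v‖ ^ 2 ≤ K₂ * (‖gradL Ω v‖ ^ 2 + ‖restrictBdry hΓ (traceL Ω v)‖ ^ 2)} :=
      isClosed_le (by fun_prop) (by fun_prop)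
    exact hc1.inter hc2
  refine ⟨1 + K₁ + (1 + K₁) * K₂, by positivity, fun v hv => ?_⟩
  obtain ⟨ht, hf⟩ := hclosure v hv.1
  rw [norm_sq_eq]
  have hK₁ : (0 : ℝ) ≤ K₁ := K₁.coe_nonneg
  have h3 := mul_le_mul_of_nonneg_left hf (by positivity : (0 : ℝ) ≤ 1 + K₁)
  have h4 : 0 ≤ (1 + (K₁ : ℝ)) * ‖restrictBdry hΓ (traceL Ω v)‖ ^ 2 := by positivity
  linarith

end TraceSpace

end TraceSpaces

/-! ### The two boundary value problems -/

section BoundaryValueProblems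

namespace TraceSpace

variable {n : ℕ} {Ω Γ₁ Γ₂ : Set (RSpace n)}

theorem formA_eq_inner (u v : SobolevH1 Ω) : formA u v = inner ℝ u.grad v.grad :=
  (L2.inner_def _ _).symm

theorem setIntegral_mul_eq_inner {Γ : Set (RSpace n)} (hΓ : Γ ⊆ frontier Ω) (b : L2Bdry Γ)
    (z : L2Bdry (frontier Ω)) :
    ∫ x in Γ, b x * z x ∂(surfaceMeasure n) = inner ℝ b (restrictBdry hΓ z) :=
  integral_mul_eq_inner _ _ (ae_eq_refl _) (coeFn_restrictBdry hΓ z)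

theorem setIntegral_mul_eq_inner' {Γ : Set (RSpace n)} (hΓ : Γ ⊆ frontier Ω)
    (w z : L2Bdry (frontier Ω)) :
    ∫ x in Γ, w x * z x ∂(surfaceMeasure n) =
      inner ℝ (restrictBdry hΓ w) (restrictBdry hΓ z) :=
  integral_mul_eq_inner _ _ (coeFn_restrictBdry hΓ w) (coeFn_restrictBdry hΓ z)

theorem formL_eq_inner (hΓ₂ : Γ₂ ⊆ frontier Ω) (g : L2Dom Ω) (q : L2Bdry Γ₂) (v : SobolevH1 Ω)
    (z : L2Bdry (frontier Ω)) :
    formL g q v z = inner ℝ g v.fn - inner ℝ q (restrictBdry hΓ₂ z) := by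
  rw [← setIntegral_mul_eq_inner, ← integral_mul_eq_inner _ _ (ae_eq_refl _) (ae_eq_refl _)]
  rfl

/-- The Hilbert space form of the problem `P`. -/
def SolvesP (hΓ₁ : Γ₁ ⊆ frontier Ω) (hΓ₂ : Γ₂ ⊆ frontier Ω) (b : L2Bdry Γ₁) (q : L2Bdry Γ₂)
    (g : L2Dom Ω) (u : TraceSpace Ω) : Prop :=
  (u ∈ traced Ω ∧ restrictBdry hΓ₁ (traceL Ω u) = b) ∧
    ∀ v ∈ traced Ω, restrictBdry hΓ₁ (traceL Ω v) = 0 →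
      inner ℝ (gradL Ω u) (gradL Ω v) =
        inner ℝ g (fnL Ω v) - inner ℝ q (restrictBdry hΓ₂ (traceL Ω v))

/-- The Hilbert space form of the problem `P_α`. -/
def SolvesPα (hΓ₁ : Γ₁ ⊆ frontier Ω) (hΓ₂ : Γ₂ ⊆ frontier Ω) (α : ℝ) (b : L2Bdry Γ₁)
    (q : L2Bdry Γ₂) (g : L2Dom Ω) (u : TraceSpace Ω) : Prop :=
  u ∈ traced Ω ∧ ∀ v ∈ traced Ω,
    inner ℝ (gradL Ω u) (gradL Ω v) +
        α * inner ℝ (restrictBdry hΓ₁ (traceL Ω u)) (restrictBdry hΓ₁ (traceL Ω v)) =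
      inner ℝ g (fnL Ω v) - inner ℝ q (restrictBdry hΓ₂ (traceL Ω v)) +
        α * inner ℝ b (restrictBdry hΓ₁ (traceL Ω v))

variable (hΓ₁ : Γ₁ ⊆ frontier Ω) (hΓ₂ : Γ₂ ⊆ frontier Ω)

theorem isSolutionP_iff
    (hT : ∀ (u : SobolevH1 Ω) (w : L2Bdry (frontier Ω)), mk u w ∈ traced Ω ↔ HasTrace u w)
    (hΓ₁ : Γ₁ ⊆ frontier Ω) (hΓ₂ : Γ₂ ⊆ frontier Ω)
    (b : L2Bdry Γ₁) (q : L2Bdry Γ₂) (g : L2Dom Ω) (u : SobolevH1 Ω) :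
    IsSolutionP b q g u ↔ ∃ w, SolvesP hΓ₁ hΓ₂ b q g (mk u w) := by
  constructor
  · rintro ⟨⟨w, hw, hb⟩, hv⟩
    refine ⟨w, ⟨(hT u w).2 hw, (agreesOn_iff hΓ₁ w b).1 hb⟩, fun v hv' hv0 => ?_⟩
    obtain ⟨v, z, rfl⟩ := exists_eq_mk hv'
    have := hv v z ((hT v z).1 hv') ((agreesOn_iff hΓ₁ z 0).2 hv0)
    rwa [formA_eq_inner, formL_eq_inner hΓ₂] at this
  · rintro ⟨w, ⟨hw, hb⟩, hv⟩
    refine ⟨⟨w, (hT u w).1 hw, (agreesOn_iff hΓ₁ w b).2 hb⟩, fun v z hz hz0 => ?_⟩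
    rw [formA_eq_inner, formL_eq_inner hΓ₂]
    exact hv (mk v z) ((hT v z).2 hz) ((agreesOn_iff hΓ₁ z 0).1 hz0)

theorem isSolutionPα_iff
    (hT : ∀ (u : SobolevH1 Ω) (w : L2Bdry (frontier Ω)), mk u w ∈ traced Ω ↔ HasTrace u w)
    (hΓ₁ : Γ₁ ⊆ frontier Ω) (hΓ₂ : Γ₂ ⊆ frontier Ω)
    (α : ℝ) (b : L2Bdry Γ₁) (q : L2Bdry Γ₂) (g : L2Dom Ω)
    (u : SobolevH1 Ω) :
    IsSolutionPα α b q g u ↔ ∃ w, SolvesPα hΓ₁ hΓ₂ α b q g (mk u w) := by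
  refine exists_congr fun w => and_congr (hT u w).symm ⟨fun h v hv => ?_, fun h v z hz => ?_⟩
  · obtain ⟨v, z, rfl⟩ := exists_eq_mk hv
    have := h v z ((hT v z).1 hv)
    rwa [formA_eq_inner, formL_eq_inner hΓ₂, setIntegral_mul_eq_inner' hΓ₁,
      setIntegral_mul_eq_inner hΓ₁] at this
  · rw [formA_eq_inner, formL_eq_inner hΓ₂, setIntegral_mul_eq_inner' hΓ₁,
      setIntegral_mul_eq_inner hΓ₁]
    exact h (mk v z) ((hT v z).2 hz)

/-- Unique solvability among triples gives unique solvability in `H¹(Ω)`, since a solution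
determines its function and its gradient. -/
theorem existsUnique_sobolevH1 {s : SobolevH1 Ω → Prop} {t : TraceSpace Ω → Prop}
    (hst : ∀ u, s u ↔ ∃ w, t (mk u w)) (ht : ∀ v, t v → v ∈ traced Ω) (h : ∃! v, t v) :
    ∃! u, s u := by
  obtain ⟨v, hv, huniq⟩ := h
  obtain ⟨u, w, rfl⟩ := exists_eq_mk (ht v hv)
  refine ⟨u, (hst u).2 ⟨w, hv⟩, fun u' hu' => ?_⟩
  obtain ⟨w', hw'⟩ := (hst u').1 hu'
  have heq := huniq _ hw'
  exact SobolevH1.ext (congrArg (fnL Ω) heq) (congrArg (gradL Ω) heq)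

/-- The energy form `∫_Ω ∇u·∇v dx + α ∫_Γ u v dγ`. -/
noncomputable def energyForm {Γ : Set (RSpace n)} (hΓ : Γ ⊆ frontier Ω) (α : ℝ) :
    TraceSpace Ω →L[ℝ] TraceSpace Ω →L[ℝ] ℝ :=
  (innerSL ℝ).bilinearComp (gradL Ω) (gradL Ω) +
    α • (innerSL ℝ).bilinearComp ((restrictBdry hΓ).comp (traceL Ω))
      ((restrictBdry hΓ).comp (traceL Ω))

theorem energyForm_apply {Γ : Set (RSpace n)} (hΓ : Γ ⊆ frontier Ω) (α : ℝ)
    (u v : TraceSpace Ω) :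
    energyForm hΓ α u v = inner ℝ (gradL Ω u) (gradL Ω v) +
      α * inner ℝ (restrictBdry hΓ (traceL Ω u)) (restrictBdry hΓ (traceL Ω v)) :=
  rfl

/-- The linear functional `∫_Ω g v dx - ∫_{Γ₂} q v dγ + ∫_{Γ₁} b v dγ`. -/
noncomputable def loadFunctional (b : L2Bdry Γ₁) (q : L2Bdry Γ₂) (g : L2Dom Ω) :
    TraceSpace Ω →L[ℝ] ℝ :=
  (innerSL ℝ g).comp (fnL Ω) - (innerSL ℝ q).comp ((restrictBdry hΓ₂).comp (traceL Ω)) +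
    (innerSL ℝ b).comp ((restrictBdry hΓ₁).comp (traceL Ω))

theorem loadFunctional_apply (b : L2Bdry Γ₁) (q : L2Bdry Γ₂) (g : L2Dom Ω) (v : TraceSpace Ω) :
    loadFunctional hΓ₁ hΓ₂ b q g v =
      inner ℝ g (fnL Ω v) - inner ℝ q (restrictBdry hΓ₂ (traceL Ω v)) +
        inner ℝ b (restrictBdry hΓ₁ (traceL Ω v)) :=
  rfl

variable {hΓ₁ hΓ₂}

/-- Existence and uniqueness for the problem `P`, where `u₀` extends the boundary data. -/
theorem existsUnique_solvesP {K : ℝ} (hK : 0 < K)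
    (hco : ∀ v ∈ traced Ω, ‖v‖ ^ 2 ≤
      K * (‖gradL Ω v‖ ^ 2 + ‖restrictBdry hΓ₁ (traceL Ω v)‖ ^ 2))
    {u₀ : TraceSpace Ω} (hu₀ : u₀ ∈ traced Ω) (q : L2Bdry Γ₂) (g : L2Dom Ω) :
    ∃! u, SolvesP hΓ₁ hΓ₂ (restrictBdry hΓ₁ (traceL Ω u₀)) q g u := by
  obtain ⟨W, hW⟩ : ∃ W : Submodule ℝ (TraceSpace Ω),
    W = traced Ω ⊓ ((restrictBdry hΓ₁).comp (traceL Ω)).ker := ⟨_, rfl⟩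
  have hmem : ∀ v, v ∈ W ↔ v ∈ traced Ω ∧ restrictBdry hΓ₁ (traceL Ω v) = 0 := by
    intro v
    rw [hW]
    exact Iff.rfl
  have hWc : IsClosed (W : Set (TraceSpace Ω)) := by
    rw [hW]
    exact isClosed_traced.inter (ContinuousLinearMap.isClosed_ker _)
  have h := existsUnique_of_coerciveOn hWc (energyForm hΓ₁ 0) (inv_pos.2 hK) (fun v hv => ?_) u₀
    (loadFunctional hΓ₁ hΓ₂ 0 q g)
  · refine (existsUnique_congr fun u => and_congr ?_ ?_).1 h
    · rw [hmem, map_sub, map_sub, sub_eq_zero]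
      exact and_congr_left fun _ => (traced Ω).sub_mem_iff_left hu₀
    · simp only [hmem, and_imp, energyForm_apply, loadFunctional_apply, zero_mul, add_zero,
        inner_zero_left]
  · rw [hmem] at hv
    have := hco v hv.1
    rw [hv.2, norm_zero] at this
    rw [energyForm_apply, real_inner_self_eq_norm_sq, zero_mul, add_zero, inv_mul_le_iff₀ hK]
    simpa using this

theorem existsUnique_solvesPα {K : ℝ} (hK : 0 < K)
    (hco : ∀ v ∈ traced Ω, ‖v‖ ^ 2 ≤
      K * (‖gradL Ω v‖ ^ 2 + ‖restrictBdry hΓ₁ (traceL Ω v)‖ ^ 2))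
    {α : ℝ} (hα : 0 < α) (b : L2Bdry Γ₁) (q : L2Bdry Γ₂) (g : L2Dom Ω) :
    ∃! u, SolvesPα hΓ₁ hΓ₂ α b q g u := by
  have hm : 0 < min 1 α := lt_min one_pos hα
  have h := existsUnique_of_coerciveOn isClosed_traced (energyForm hΓ₁ α)
    (mul_pos (inv_pos.2 hK) hm) (fun v hv => ?_) 0 (loadFunctional hΓ₁ hΓ₂ (α • b) q g)
  · refine (existsUnique_congr fun u => and_congr ?_ ?_).1 h
    · rw [sub_zero]
    · simp only [energyForm_apply, loadFunctional_apply, inner_smul_left]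
      rfl
  · rw [energyForm_apply, real_inner_self_eq_norm_sq, real_inner_self_eq_norm_sq, mul_assoc,
      inv_mul_le_iff₀ hK]
    have h1 := mul_le_mul_of_nonneg_left (hco v hv) hm.le
    have h2 : min 1 α * ‖gradL Ω v‖ ^ 2 ≤ 1 * ‖gradL Ω v‖ ^ 2 := by
      gcongr
      exact min_le_left _ _
    have h3 : min 1 α * ‖restrictBdry hΓ₁ (traceL Ω v)‖ ^ 2 ≤
        α * ‖restrictBdry hΓ₁ (traceL Ω v)‖ ^ 2 := by
      gcongr
      exact min_le_right _ _
    have h4 := mul_le_mul_of_nonneg_left (add_le_add h2 h3) hK.le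
    linarith

theorem SolvesP.superpose {b : L2Bdry Γ₁} {q : L2Bdry Γ₂} {g : L2Dom Ω}
    {ub uq ug : TraceSpace Ω} (hb : SolvesP hΓ₁ hΓ₂ b 0 0 ub) (hq : SolvesP hΓ₁ hΓ₂ 0 q 0 uq)
    (hg : SolvesP hΓ₁ hΓ₂ 0 0 g ug) (m : ℝ) :
    SolvesP hΓ₁ hΓ₂ b (m • q) g (ub + ug + m • uq) := by
  refine ⟨⟨add_mem (add_mem hb.1.1 hg.1.1) (Submodule.smul_mem _ m hq.1.1), ?_⟩,
    fun v hv hv0 => ?_⟩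
  · simp [hb.1.2, hq.1.2, hg.1.2]
  · have h1 := hb.2 v hv hv0
    have h2 := hq.2 v hv hv0
    have h3 := hg.2 v hv hv0
    simp only [inner_zero_left] at h1 h2 h3
    simp only [map_add, map_smul, inner_add_left, real_inner_smul_left, h1, h2, h3]
    ring

theorem SolvesPα.superpose {α : ℝ} {b : L2Bdry Γ₁} {q : L2Bdry Γ₂} {g : L2Dom Ω}
    {ub uq ug : TraceSpace Ω} (hb : SolvesPα hΓ₁ hΓ₂ α b 0 0 ub)
    (hq : SolvesPα hΓ₁ hΓ₂ α 0 q 0 uq) (hg : SolvesPα hΓ₁ hΓ₂ α 0 0 g ug) (m : ℝ) :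
    SolvesPα hΓ₁ hΓ₂ α b (m • q) g (ub + ug + m • uq) := by
  refine ⟨add_mem (add_mem hb.1 hg.1) (Submodule.smul_mem _ m hq.1), fun v hv => ?_⟩
  have h1 := hb.2 v hv
  have h2 := hq.2 v hv
  have h3 := hg.2 v hv
  simp only [inner_zero_left] at h1 h2 h3
  simp only [map_add, map_smul, inner_add_left, real_inner_smul_left]
  linear_combination h1 + m * h2 + h3

/-- Transfer of a superposition principle from triples to functions of `H¹(Ω)`. -/
theorem exists_fn_eq_superposition {sb sq sg s : SobolevH1 Ω → Prop}
    {tb tq tg t : TraceSpace Ω → Prop} {m : ℝ} (hsb : ∀ u, sb u ↔ ∃ w, tb (mk u w))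
    (hsq : ∀ u, sq u ↔ ∃ w, tq (mk u w)) (hsg : ∀ u, sg u ↔ ∃ w, tg (mk u w))
    (hs : ∀ u, s u ↔ ∃ w, t (mk u w)) (ht : ∀ v, t v → v ∈ traced Ω)
    (hsuper : ∀ ub uq ug, tb ub → tq uq → tg ug → t (ub + ug + m • uq))
    {ub uq ug : SobolevH1 Ω} (hub : sb ub) (huq : sq uq) (hug : sg ug) :
    ∃ u, s u ∧ u.fn = ub.fn + ug.fn + m • uq.fn := by
  obtain ⟨wb, hwb⟩ := (hsb ub).1 hub
  obtain ⟨wq, hwq⟩ := (hsq uq).1 huq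
  obtain ⟨wg, hwg⟩ := (hsg ug).1 hug
  have h := hsuper _ _ _ hwb hwq hwg
  obtain ⟨u, w, huw⟩ := exists_eq_mk (ht _ h)
  refine ⟨u, (hs u).2 ⟨w, huw ▸ h⟩, ?_⟩
  have := congrArg (fnL Ω) huw
  simpa using this.symm

end TraceSpace

end BoundaryValueProblems

/-! ### Minimization along a line of fluxes -/

section QuadraticMinimization

/-- A quadratic tracking functional with Tikhonov term has exactly one minimizer along a line. -/
theorem isRealMinimizer_quadratic {H Q : Type*} [NormedAddCommGroup H] [InnerProductSpace ℝ H]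
    [NormedAddCommGroup Q] [InnerProductSpace ℝ Q] {M : ℝ} (hM : 0 < M) {q : Q} (hq : q ≠ 0)
    (x y : H) {F : ℝ → ℝ} (hF : ∀ m, F m = 1 / 2 * ‖x + m • y‖ ^ 2 + M / 2 * ‖m • q‖ ^ 2)
    {A B : ℝ} (hA : A = M / 2 * ‖q‖ ^ 2 + 1 / 2 * ‖y‖ ^ 2) (hB : B = inner ℝ y x) :
    0 < A ∧ IsRealMinimizer F (-B / (2 * A)) ∧ ∀ l, IsRealMinimizer F l → l = -B / (2 * A) := by
  have hq0 : 0 < ‖q‖ := norm_pos_iff.2 hq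
  have hA0 : 0 < A := by rw [hA]; positivity
  -- Completing the square.
  have hsq : ∀ m, F m = F (-B / (2 * A)) + A * (m - -B / (2 * A)) ^ 2 := by
    have hFq : ∀ m, F m = 1 / 2 * ‖x‖ ^ 2 + B * m + A * m ^ 2 := by
      intro m
      rw [hF, norm_add_sq_real, real_inner_smul_right, norm_smul, norm_smul, mul_pow, mul_pow,
        Real.norm_eq_abs, sq_abs, real_inner_comm, hA, hB]
      ring
    intro m
    rw [hFq, hFq (-B / (2 * A))]
    field_simp
    ring
  refine ⟨hA0, fun m => ?_, fun l hl => ?_⟩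
  · rw [hsq m]
    have : 0 ≤ A * (m - -B / (2 * A)) ^ 2 := by positivity
    linarith
  · have h := hl (-B / (2 * A))
    rw [hsq l] at h
    have h0 : (l - -B / (2 * A)) ^ 2 = 0 := by
      refine le_antisymm ?_ (sq_nonneg _)
      by_contra! hpos
      have := mul_pos hA0 hpos
      linarith
    exact sub_eq_zero.1 (pow_eq_zero_iff two_ne_zero |>.1 h0)

variable {n : ℕ} {Ω Γ₁ Γ₂ : Set (RSpace n)}

theorem coeffA_eq_norm_sq (M : ℝ) (q : L2Bdry Γ₂) (u : L2Dom Ω) :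
    coeffA M q u = M / 2 * ‖q‖ ^ 2 + 1 / 2 * ‖u‖ ^ 2 := by
  rw [← real_inner_self_eq_norm_sq, ← real_inner_self_eq_norm_sq,
    ← integral_mul_eq_inner q q (ae_eq_refl _) (ae_eq_refl _),
    ← integral_mul_eq_inner u u (ae_eq_refl _) (ae_eq_refl _)]
  simp only [← sq]
  rfl

theorem coeffB_eq_inner (uq ub ug zd : L2Dom Ω) :
    coeffB uq ub ug zd = inner ℝ uq (ub + ug - zd) := by
  refine integral_mul_eq_inner _ _ (ae_eq_refl _) ?_
  filter_upwards [Lp.coeFn_sub (ub + ug) zd, Lp.coeFn_add ub ug] with x h1 h2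
  rw [h1, Pi.sub_apply, h2, Pi.add_apply]

/-- If the state depends affinely on the flux along a line, the cost functional along this line
has exactly one minimizer, namely `-B / (2 A)`. -/
theorem minimization_of_superposition {M : ℝ} (hM : 0 < M) {q₀ : L2Bdry Γ₂} (hq₀ : q₀ ≠ 0)
    (zd : L2Dom Ω) {sb sq sg : SobolevH1 Ω → Prop} (hb : ∃ u, sb u) (hq : ∃ u, sq u)
    (hg : ∃ u, sg u) {state : L2Bdry Γ₂ → L2Dom Ω}
    (hstate : ∀ ub uq ug, sb ub → sq uq → sg ug → ∀ m : ℝ,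
      state (m • q₀) = ub.fn + ug.fn + m • uq.fn) {J : L2Bdry Γ₂ → ℝ}
    (hJ : ∀ q, J q = 1 / 2 * ‖state q - zd‖ ^ 2 + M / 2 * ‖q‖ ^ 2) :
    (∃! l : ℝ, IsRealMinimizer (fun m => J (m • q₀)) l) ∧
      ∀ ub uq ug : SobolevH1 Ω, sb ub → sq uq → sg ug →
        0 < coeffA M q₀ uq.fn ∧
        IsRealMinimizer (fun m => J (m • q₀))
          (-coeffB uq.fn ub.fn ug.fn zd / (2 * coeffA M q₀ uq.fn)) := by
  have key : ∀ ub uq ug : SobolevH1 Ω, sb ub → sq uq → sg ug → _ := fun ub uq ug h1 h2 h3 =>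
    isRealMinimizer_quadratic hM hq₀ (ub.fn + ug.fn - zd) uq.fn (F := fun m => J (m • q₀))
      (fun m => by
        simp only [hJ, hstate ub uq ug h1 h2 h3]
        rw [add_sub_right_comm])
      (coeffA_eq_norm_sq M q₀ uq.fn) (coeffB_eq_inner uq.fn ub.fn ug.fn zd)
  refine ⟨?_, fun ub uq ug h1 h2 h3 => ?_⟩
  · obtain ⟨ub, h1⟩ := hb
    obtain ⟨uq, h2⟩ := hq
    obtain ⟨ug, h3⟩ := hg
    obtain ⟨_, hmin, huniq⟩ := key ub uq ug h1 h2 h3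
    exact ⟨_, hmin, huniq⟩
  · obtain ⟨hpos, hmin, _⟩ := key ub uq ug h1 h2 h3
    exact ⟨hpos, hmin⟩

theorem stateP_eq {b : L2Bdry Γ₁} {q : L2Bdry Γ₂} {g : L2Dom Ω} {u : SobolevH1 Ω}
    (h : ∃! u : SobolevH1 Ω, IsSolutionP b q g u) (hu : IsSolutionP b q g u) :
    stateP b q g = u.fn := by
  rw [stateP, dif_pos ⟨u, hu⟩]
  exact congrArg SobolevH1.fn (h.unique (Exists.choose_spec _) hu)

theorem statePα_eq {α : ℝ} {b : L2Bdry Γ₁} {q : L2Bdry Γ₂} {g : L2Dom Ω} {u : SobolevH1 Ω}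
    (h : ∃! u : SobolevH1 Ω, IsSolutionPα α b q g u) (hu : IsSolutionPα α b q g u) :
    statePα α b q g = u.fn := by
  rw [statePα, dif_pos ⟨u, hu⟩]
  exact congrArg SobolevH1.fn (h.unique (Exists.choose_spec _) hu)

theorem memHHalf_iff
    (hT : ∀ (u : SobolevH1 Ω) (w : L2Bdry (frontier Ω)),
      TraceSpace.mk u w ∈ TraceSpace.traced Ω ↔ HasTrace u w)
    (hΓ₁ : Γ₁ ⊆ frontier Ω) (b : L2Bdry Γ₁) :
    MemHHalf Ω Γ₁ b ↔ ∃ u ∈ TraceSpace.traced Ω,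
      restrictBdry hΓ₁ (TraceSpace.traceL Ω u) = b := by
  constructor
  · rintro ⟨v, w, hw, hb⟩
    exact ⟨TraceSpace.mk v w, (hT v w).2 hw, (agreesOn_iff hΓ₁ w b).1 hb⟩
  · rintro ⟨u, hu, hb⟩
    obtain ⟨v, w, rfl⟩ := TraceSpace.exists_eq_mk hu
    exact ⟨v, w, (hT v w).1 hu, (agreesOn_iff hΓ₁ w b).2 hb⟩

end QuadraticMinimization

theorem mainTheorem11 (n : ℕ) (Ω Γ₁ Γ₂ : Set (RSpace n))
    (hΩ_open : IsOpen Ω) (hΩ_conn : IsConnected Ω) (hΩ_bdd : Bornology.IsBounded Ω)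
    (hΩ_lip : HasLipschitzBoundary Ω)
    (hΓ₁ : MeasurableSet Γ₁) (hΓ₂ : MeasurableSet Γ₂) (hΓ_disj : Disjoint Γ₁ Γ₂)
    (hΓ_union : Γ₁ ∪ Γ₂ = frontier Ω)
    (hΓ₁_pos : 0 < surfaceMeasure n Γ₁) (hΓ₂_pos : 0 < surfaceMeasure n Γ₂)
    (M : ℝ) (hM : 0 < M) (g zd : L2Dom Ω) (b : L2Bdry Γ₁) (hb : MemHHalf Ω Γ₁ b)
    (q₀ : L2Bdry Γ₂) (hq₀ : q₀ ≠ 0) :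
    -- the problem `P`
    ((∀ (b' : L2Bdry Γ₁) (q' : L2Bdry Γ₂) (g' : L2Dom Ω), MemHHalf Ω Γ₁ b' →
        ∃! u : SobolevH1 Ω, IsSolutionP b' q' g' u) ∧
      (∃! l : ℝ, IsRealMinimizer (fun m => costP M b g zd (m • q₀)) l) ∧
      ∀ ub uq ug : SobolevH1 Ω,
        IsSolutionP b (0 : L2Bdry Γ₂) 0 ub →
        IsSolutionP (0 : L2Bdry Γ₁) q₀ 0 uq →
        IsSolutionP (0 : L2Bdry Γ₁) (0 : L2Bdry Γ₂) g ug →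
        0 < coeffA M q₀ uq.fn ∧
        IsRealMinimizer (fun m => costP M b g zd (m • q₀))
          (-coeffB uq.fn ub.fn ug.fn zd / (2 * coeffA M q₀ uq.fn))) ∧
    -- the problems `P_α`
    ∀ α : ℝ, 0 < α →
      (∀ (b' : L2Bdry Γ₁) (q' : L2Bdry Γ₂) (g' : L2Dom Ω), MemHHalf Ω Γ₁ b' →
        ∃! u : SobolevH1 Ω, IsSolutionPα α b' q' g' u) ∧
      (∃! l : ℝ, IsRealMinimizer (fun m => costPα M α b g zd (m • q₀)) l) ∧
      ∀ ub uq ug : SobolevH1 Ω,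
        IsSolutionPα α b (0 : L2Bdry Γ₂) 0 ub →
        IsSolutionPα α (0 : L2Bdry Γ₁) q₀ 0 uq →
        IsSolutionPα α (0 : L2Bdry Γ₁) (0 : L2Bdry Γ₂) g ug →
        0 < coeffA M q₀ uq.fn ∧
        IsRealMinimizer (fun m => costPα M α b g zd (m • q₀))
          (-coeffB uq.fn ub.fn ug.fn zd / (2 * coeffA M q₀ uq.fn)) := by
  have hΓ₁f : Γ₁ ⊆ frontier Ω := hΓ_union ▸ Set.subset_union_left
  have hΓ₂f : Γ₂ ⊆ frontier Ω := hΓ_union ▸ Set.subset_union_right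
  have hfin := (poincarePair_of_hasLipschitzBoundary hΩ_open hΩ_conn hΩ_bdd hΩ_lip).1
  have hT := TraceSpace.mk_mem_traced_iff hΩ_open hΩ_bdd hfin
  obtain ⟨K, hK, hco⟩ :=
    TraceSpace.exists_norm_sq_le hΩ_open hΩ_conn hΩ_bdd hΩ_lip hΓ₁f hΓ₁_pos
  have h0 : MemHHalf Ω Γ₁ 0 := (memHHalf_iff hT hΓ₁f 0).2 ⟨0, zero_mem _, by simp⟩
  constructor
  · have hex : ∀ (b' : L2Bdry Γ₁) (q' : L2Bdry Γ₂) (g' : L2Dom Ω), MemHHalf Ω Γ₁ b' →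
        ∃! u : SobolevH1 Ω, IsSolutionP b' q' g' u := by
      intro b' q' g' hb'
      obtain ⟨u₀, hu₀, rfl⟩ := (memHHalf_iff hT hΓ₁f b').1 hb'
      exact TraceSpace.existsUnique_sobolevH1 (TraceSpace.isSolutionP_iff hT hΓ₁f hΓ₂f _ q' g')
        (fun v hv => hv.1.1) (TraceSpace.existsUnique_solvesP hK hco hu₀ q' g')
    refine ⟨hex, minimization_of_superposition hM hq₀ zd (hex b 0 0 hb).exists
      (hex 0 q₀ 0 h0).exists (hex 0 0 g h0).exists (state := fun q => stateP b q g)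
      (fun ub uq ug h1 h2 h3 m => ?_) fun q => rfl⟩
    obtain ⟨u, hu, hfn⟩ := TraceSpace.exists_fn_eq_superposition
      (TraceSpace.isSolutionP_iff hT hΓ₁f hΓ₂f b 0 0)
      (TraceSpace.isSolutionP_iff hT hΓ₁f hΓ₂f 0 q₀ 0)
      (TraceSpace.isSolutionP_iff hT hΓ₁f hΓ₂f 0 0 g)
      (TraceSpace.isSolutionP_iff hT hΓ₁f hΓ₂f b (m • q₀) g) (fun v hv => hv.1.1)
      (fun _ _ _ h1 h2 h3 => h1.superpose h2 h3 m) h1 h2 h3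
    rw [← hfn]
    exact stateP_eq (hex b (m • q₀) g hb) hu
  · intro α hα
    have hex : ∀ (b' : L2Bdry Γ₁) (q' : L2Bdry Γ₂) (g' : L2Dom Ω),
        ∃! u : SobolevH1 Ω, IsSolutionPα α b' q' g' u := fun b' q' g' =>
      TraceSpace.existsUnique_sobolevH1 (TraceSpace.isSolutionPα_iff hT hΓ₁f hΓ₂f α b' q' g')
        (fun v hv => hv.1) (TraceSpace.existsUnique_solvesPα hK hco hα b' q' g')
    refine ⟨fun b' q' g' _ => hex b' q' g', minimization_of_superposition hM hq₀ zd
      (hex b 0 0).exists (hex 0 q₀ 0).exists (hex 0 0 g).exists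
      (state := fun q => statePα α b q g) (fun ub uq ug h1 h2 h3 m => ?_) fun q => rfl⟩
    obtain ⟨u, hu, hfn⟩ := TraceSpace.exists_fn_eq_superposition
      (TraceSpace.isSolutionPα_iff hT hΓ₁f hΓ₂f α b 0 0)
      (TraceSpace.isSolutionPα_iff hT hΓ₁f hΓ₂f α 0 q₀ 0)
      (TraceSpace.isSolutionPα_iff hT hΓ₁f hΓ₂f α 0 0 g)
      (TraceSpace.isSolutionPα_iff hT hΓ₁f hΓ₂f α b (m • q₀) g) (fun v hv => hv.1)
      (fun _ _ _ h1 h2 h3 => h1.superpose h2 h3 m) h1 h2 h3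
    rw [← hfn]
    exact statePα_eq (hex b (m • q₀) g) hu
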